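/- For matrices $A\in\mathbb R^{d_1\times k}$, $B\in\mathbb R^{d_2\times k}$ let $A\odot B\in\mathbb R^{d_1d_2\times k}$ be their Khatri–Rao product, $(A\odot B)_{(i_1,i_2),j}=A_{i_1,j}B_{i_2,j}$. Let $\|\cdot\|$ be the spectral norm, and let $\operatorname{diag}(M)$ be the diagonal part of a square matrix $M$. For all $A,B\in\mathbb R^{d\times k}$, the matrix $(A\odot B)^\top(A\odot B)$ is the entrywise (Hadamard) product of $A^\top A$ and $B^\top B$. Moreover, there are absolute exponents $p,q\in\mathbb N$ such that for every $c>0$ there are $C>0$ and $d_0\in\mathbb N$ with the following property. Let $d\ge d_0$, let $k$ satisfy $(\log d)^p<k\le d^2/(\log d)^q$, and let $A,B\in\mathbb R^{d\times k}$ be independent random matrices, each with independent $N(0,1)$ entries. 1. Let $M=(A\odot B)^\top(A\odot B)$. With probability at least $1-d^{-c}$, $$\|M-\operatorname{diag}(M)\|\le C\,d\sqrt{k\log d}.$$ 2. Let $\hat A,\hat B$ be obtained from $A,B$ by dividing every column by its Euclidean norm. With probability at least $1-d^{-c}$, $$\|(\hat A\odot\hat B)^\top(\hat A\odot\hat B)-I\|\le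 C\,\frac{\sqrt{k\log d}}{d}.$$ -/

import Mathlib

open MeasureTheory ProbabilityTheory

-- `‖M‖` for a real matrix `M` is the spectral norm (operator norm for the Euclidean norms).
open scoped Matrix.Norms.L2Operator

/-- The Khatri–Rao (column-wise Kronecker) product of two matrices with the same columns. -/
def khatriRao {m n κ : Type*} (A : Matrix m κ ℝ) (B : Matrix n κ ℝ) : Matrix (m × n) κ ℝ :=
  Matrix.of fun i j => A i.1 j * B i.2 j

/-- The Gram matrix of the columns of the Khatri–Rao product of `A` and `B`. -/
def khatriRaoGram {d k : ℕ} (A B : Matrix (Fin d) (Fin k) ℝ) : Matrix (Fin k) (Fin k) ℝ :=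
  (khatriRao A B).transpose * khatriRao A B

/-- Divide every column by its Euclidean norm (a zero column stays zero). -/
noncomputable def normalizeCols {d k : ℕ} (A : Matrix (Fin d) (Fin k) ℝ) :
    Matrix (Fin d) (Fin k) ℝ :=
  Matrix.of fun i j => A i j / √(∑ l, A l j ^ 2)

/-- A random `d × k` matrix whose entries are independent standard Gaussian variables. -/
structure IsGaussianMatrix {Ω : Type*} [MeasurableSpace Ω] {d k : ℕ}
    (A : Ω → Matrix (Fin d) (Fin k) ℝ) (P : Measure Ω) : Prop where
  hasLaw : ∀ i j, HasLaw (fun ω => A ω i j) (gaussianReal 0 1) P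
  indep : iIndepFun (fun (ij : Fin d × Fin k) ω => A ω ij.1 ij.2) P

/-! ### Forms, norms and traces of positive semidefinite matrices -/

section LinearAlgebra

open Matrix

variable {n : Type*} [Fintype n] [DecidableEq n]

/-! The off-diagonal part of `M` is the off-diagonal part of the Gram matrix of the independent
vectors x_j = a_j ⊗ b_j in dimension d². These are isotropic, E⟨u,x⟩² = |u|², and outside of small
events |x_j|² ≤ r = 64d² and ⟨x_i,x_j⟩² ≤ Lr for i ≠ j, with L of order (log d)².

The engine is a moment bound of matrix Bernstein type: if s independent vectors y_j in dimension N
satisfy |y_j|² ≤ R and have second moment matrices at most σ, then E tr (Σ y_j y_jᵀ)^m ≤ N (sσ +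
mR)^m (`integral_trace_rankOneSum_pow_le`). One factor of the power is peeled off, leaving forms
y_jᵀ S^m y_j in which y_j also enters S. Replacing y_j y_jᵀ by R·1 does not decrease the form
(`dotProduct_pow_rankOne_update_le`) and makes S independent of y_j, at the cost of a scalar shift
that the induction carries along.

To apply it to a Gram matrix, decouple. For a set S of indices take the block with rows in S and
columns outside. Given the rows Z in S, the block times its transpose is a sum over j ∉ S of the
rank-one matrices of Z x_j, which are independent with second moments at most ‖Z‖²
(`lintegral_indicator_norm_crossGram_le`). A pair i ≠ j is caught by a quarter of all S, so
averaging over S and convexity recover the off-diagonal part (`norm_offGram_pow_le`).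

The moment bound is used three times, up to constants (`measure_norm_offGram_gt_le`): for the x_j
themselves it gives σ = k + mr as a bound for the squared norm of the matrix of all vectors; for S =
{j} it gives R = kr + mLr for the squared rows of the off-diagonal part; for general S these two
give kσ + mR for its squared norm. With m of order log d this is k² + k d² log d + d² (log d)⁴,
which is O(d² k log d) because k ≤ d² and k > (log d)³; Markov's inequality makes the failure
probability polynomially small. Normalizing the columns makes the diagonal exactly 1 and multiplies
the off-diagonal part on both sides by a diagonal matrix of norm O(1/d). -/

lemma Matrix.PosSemidef.exists_orthogonal_diagonalization {H : Matrix n n ℝ} (hH : H.PosSemidef) :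
    ∃ (U : Matrix n n ℝ) (l : n → ℝ), U * Uᵀ = 1 ∧ Uᵀ * U = 1 ∧ (∀ i, 0 ≤ l i) ∧
      H = U * diagonal l * Uᵀ := by
  refine ⟨hH.1.eigenvectorUnitary, hH.1.eigenvalues, ?_, ?_, hH.eigenvalues_nonneg, ?_⟩
  · simpa [star_eq_conjTranspose] using Unitary.coe_mul_star_self hH.1.eigenvectorUnitary
  · simpa [star_eq_conjTranspose] using Unitary.coe_star_mul_self hH.1.eigenvectorUnitary
  · have h := hH.1.spectral_theorem
    rw [Unitary.conjStarAlgAut_apply] at h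
    simpa [star_eq_conjTranspose] using h

lemma orthogonal_conj_mul {U D E : Matrix n n ℝ} (hU : Uᵀ * U = 1) :
    (U * D * Uᵀ) * (U * E * Uᵀ) = U * (D * E) * Uᵀ := by
  calc (U * D * Uᵀ) * (U * E * Uᵀ) = U * D * (Uᵀ * U) * E * Uᵀ := by simp only [Matrix.mul_assoc]
    _ = _ := by rw [hU]; simp only [Matrix.mul_assoc, Matrix.one_mul]

lemma orthogonal_conj_pow {U : Matrix n n ℝ} (l : n → ℝ) (hU : Uᵀ * U = 1) (hU' : U * Uᵀ = 1)
    (r : ℕ) : (U * diagonal l * Uᵀ) ^ r = U * diagonal (fun i => l i ^ r) * Uᵀ := by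
  induction r with
  | zero => simp [hU']
  | succ r ih => rw [pow_succ, ih, orthogonal_conj_mul hU, diagonal_mul_diagonal]; simp [pow_succ]

lemma orthogonal_conj_form (U : Matrix n n ℝ) (l y : n → ℝ) :
    y ⬝ᵥ (U * diagonal l * Uᵀ) *ᵥ y = ∑ i, l i * (y ᵥ* U) i ^ 2 := by
  rw [← mulVec_mulVec, ← mulVec_mulVec, dotProduct_mulVec, dotProduct, mulVec_transpose]
  refine Finset.sum_congr rfl fun i _ => ?_
  rw [mulVec_diagonal]
  ring

omit [DecidableEq n] in
/-- Chebyshev's sum inequality with weights. -/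
lemma sum_weight_mul_sum_weight_le (w f g : n → ℝ) (hw : ∀ i, 0 ≤ w i)
    (hfg : ∀ i j, 0 ≤ (f i - f j) * (g i - g j)) :
    (∑ i, f i * w i) * (∑ i, g i * w i) ≤ (∑ i, w i) * ∑ i, f i * g i * w i := by
  have h : 0 ≤ ∑ i, ∑ j, w i * w j * ((f i - f j) * (g i - g j)) :=
    Finset.sum_nonneg fun i _ => Finset.sum_nonneg fun j _ =>
      mul_nonneg (mul_nonneg (hw i) (hw j)) (hfg i j)
  have e : ∑ i, ∑ j, w i * w j * ((f i - f j) * (g i - g j)) =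
      2 * ((∑ i, w i) * ∑ i, f i * g i * w i) - 2 * ((∑ i, f i * w i) * (∑ i, g i * w i)) := by
    have e1 : ∀ i j, w i * w j * ((f i - f j) * (g i - g j)) =
        (f i * g i * w i) * w j + w i * (f j * g j * w j) - (f i * w i) * (g j * w j)
          - (g i * w i) * (f j * w j) := fun i j => by ring
    simp only [e1, Finset.sum_add_distrib, Finset.sum_sub_distrib, ← Finset.mul_sum,
      ← Finset.sum_mul]
    ring
  linarith

/-- In an eigenbasis of `H` both powers are nondecreasing functions of the eigenvalue, hence
positively correlated under the weights given by the squared coordinates of `y`. -/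
lemma dotProduct_pow_mul_le {H : Matrix n n ℝ} (hH : H.PosSemidef) {R : ℝ} (hR : 0 ≤ R)
    (y : n → ℝ) (a r : ℕ) :
    (y ⬝ᵥ (H ^ a) *ᵥ y) * (y ⬝ᵥ ((H + R • 1) ^ r) *ᵥ y) ≤
      (y ⬝ᵥ y) * (y ⬝ᵥ (H ^ a * (H + R • 1) ^ r) *ᵥ y) := by
  obtain ⟨U, l, hU, hU', hl, rfl⟩ := hH.exists_orthogonal_diagonalization
  have e : U * diagonal l * Uᵀ + R • (1 : Matrix n n ℝ) = U * diagonal (fun i => l i + R) * Uᵀ := by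
    have : diagonal (fun i => l i + R) = diagonal l + R • (1 : Matrix n n ℝ) := by
      ext i j; by_cases h : i = j <;> simp [h]
    rw [this]
    simp [Matrix.mul_add, Matrix.add_mul, hU]
  have e1 : y ⬝ᵥ y = ∑ i, (y ᵥ* U) i ^ 2 := by
    have := orthogonal_conj_form U 1 y
    simpa [hU] using this
  rw [e, orthogonal_conj_pow _ hU' hU, orthogonal_conj_pow _ hU' hU, orthogonal_conj_mul hU',
    diagonal_mul_diagonal, orthogonal_conj_form, orthogonal_conj_form, orthogonal_conj_form, e1]
  refine sum_weight_mul_sum_weight_le _ _ _ (fun i => sq_nonneg _) fun i j => ?_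
  rcases le_total (l i) (l j) with h | h
  · exact mul_nonneg_of_nonpos_of_nonpos
      (sub_nonpos.2 (pow_le_pow_left₀ (hl i) h _))
      (sub_nonpos.2 (pow_le_pow_left₀ (by linarith [hl i]) (by linarith) _))
  · exact mul_nonneg
      (sub_nonneg.2 (pow_le_pow_left₀ (hl j) h _))
      (sub_nonneg.2 (pow_le_pow_left₀ (by linarith [hl j]) (by linarith) _))

lemma Matrix.PosSemidef.dotProduct_self_mulVec_nonneg {H : Matrix n n ℝ} (hH : H.PosSemidef)
    (y : n → ℝ) : 0 ≤ y ⬝ᵥ H *ᵥ y := by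
  obtain ⟨U, l, -, -, hl, rfl⟩ := hH.exists_orthogonal_diagonalization
  rw [orthogonal_conj_form]
  exact Finset.sum_nonneg fun i _ => mul_nonneg (hl i) (sq_nonneg _)

omit [DecidableEq n] in
lemma posSemidef_vecMulVec_self (y : n → ℝ) : (vecMulVec y y).PosSemidef := by
  simpa using posSemidef_vecMulVec_self_star y

omit [Fintype n] in
lemma posSemidef_smul_one {t : ℝ} (ht : 0 ≤ t) : (t • (1 : Matrix n n ℝ)).PosSemidef :=
  PosSemidef.one.smul ht

lemma dotProduct_pow_mul_shift_pow_succ (H : Matrix n n ℝ) (R : ℝ) (y : n → ℝ) (a r : ℕ) :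
    y ⬝ᵥ (H ^ a * (H + R • 1) ^ (r + 1)) *ᵥ y =
      y ⬝ᵥ (H ^ (a + 1) * (H + R • 1) ^ r) *ᵥ y +
        R * (y ⬝ᵥ (H ^ a * (H + R • 1) ^ r) *ᵥ y) := by
  rw [pow_succ' _ r, Matrix.add_mul, Matrix.mul_add, Matrix.add_mulVec, dotProduct_add,
    ← Matrix.mul_assoc, ← pow_succ]
  simp [smul_mulVec]

lemma dotProduct_pow_mul_shift_pow_nonneg {H : Matrix n n ℝ} (hH : H.PosSemidef) {R : ℝ}
    (hR : 0 ≤ R) (y : n → ℝ) (a r : ℕ) : 0 ≤ y ⬝ᵥ (H ^ a * (H + R • 1) ^ r) *ᵥ y := by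
  induction r generalizing a with
  | zero => simpa using (hH.pow a).dotProduct_self_mulVec_nonneg y
  | succ r ih =>
    rw [dotProduct_pow_mul_shift_pow_succ]
    exact add_nonneg (ih _) (mul_nonneg hR (ih _))

/-- A rank-one update `y yᵀ` may be replaced by the multiple `R • 1` in the form at `y`. -/
lemma dotProduct_pow_rankOne_update_le {H : Matrix n n ℝ} (hH : H.PosSemidef) {R : ℝ}
    {y : n → ℝ} (hy : y ⬝ᵥ y ≤ R) (r a : ℕ) :
    y ⬝ᵥ (H ^ a * (H + vecMulVec y y) ^ r) *ᵥ y ≤ y ⬝ᵥ (H ^ a * (H + R • 1) ^ r) *ᵥ y := by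
  -- The exponent `a` is general because expanding one factor `H + y yᵀ` moves its `H` into `H ^ a`.
  -- Its rank-one part splits the form into a product of two forms, which Chebyshev's inequality
  -- recombines with the factor `y ⬝ᵥ y ≤ R`.
  have hR : 0 ≤ R := le_trans (dotProduct_self_star_nonneg y) (by simpa using hy)
  induction r generalizing a with
  | zero => simp
  | succ r ih =>
    have e1 : y ⬝ᵥ (H ^ a * (H + vecMulVec y y) ^ (r + 1)) *ᵥ y =
        y ⬝ᵥ (H ^ (a + 1) * (H + vecMulVec y y) ^ r) *ᵥ y +
        (y ⬝ᵥ (H ^ a) *ᵥ y) * (y ⬝ᵥ ((H + vecMulVec y y) ^ r) *ᵥ y) := by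
      rw [pow_succ' _ r, Matrix.add_mul, Matrix.mul_add, Matrix.add_mulVec, dotProduct_add,
        ← Matrix.mul_assoc, ← pow_succ]
      congr 1
      rw [← mulVec_mulVec, ← mulVec_mulVec, vecMulVec_mulVec]
      simp [mulVec_smul, mul_comm]
    have h0 := ih 0
    simp only [pow_zero, Matrix.one_mul] at h0
    have h2 := dotProduct_pow_mul_le hH hR y a r
    have h3 : 0 ≤ y ⬝ᵥ (H ^ a) *ᵥ y := (hH.pow a).dotProduct_self_mulVec_nonneg y
    have h4 : 0 ≤ y ⬝ᵥ (H ^ a * (H + R • 1) ^ r) *ᵥ y :=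
      dotProduct_pow_mul_shift_pow_nonneg hH hR y a r
    rw [e1, dotProduct_pow_mul_shift_pow_succ]
    refine add_le_add (ih (a + 1)) ?_
    calc _ ≤ (y ⬝ᵥ (H ^ a) *ᵥ y) * (y ⬝ᵥ ((H + R • 1) ^ r) *ᵥ y) :=
          mul_le_mul_of_nonneg_left h0 h3
      _ ≤ _ := h2
      _ ≤ _ := mul_le_mul_of_nonneg_right hy h4

lemma l2_opNorm_le_one_of_orthogonal {U : Matrix n n ℝ} (hU : Uᵀ * U = 1) : ‖U‖ ≤ 1 := by
  have h := l2_opNorm_conjTranspose_mul_self U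
  rw [conjTranspose_eq_transpose_of_trivial, hU] at h
  have h1 : ‖(1 : Matrix n n ℝ)‖ ≤ 1 := by
    rw [← diagonal_one, l2_opNorm_diagonal]
    exact (pi_norm_le_iff_of_nonneg zero_le_one).2 fun i => by simp
  nlinarith [norm_nonneg U]

/-- The norm is at most the largest eigenvalue, whose `m`-th power is one term of the trace. For `m
= 0` and an empty index type the trace would be 0. -/
lemma Matrix.PosSemidef.norm_pow_le_trace_pow {S : Matrix n n ℝ} (hS : S.PosSemidef) {m : ℕ}
    (hm : m ≠ 0) : ‖S‖ ^ m ≤ (S ^ m).trace := by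
  obtain ⟨U, l, hU, hU', hl, rfl⟩ := hS.exists_orthogonal_diagonalization
  have ht : ((U * diagonal l * Uᵀ) ^ m).trace = ∑ i, l i ^ m := by
    rw [orthogonal_conj_pow _ hU' hU, trace_mul_comm, ← Matrix.mul_assoc, hU', Matrix.one_mul,
      trace_diagonal]
  have hnn : 0 ≤ ∑ i, l i ^ m := Finset.sum_nonneg fun i _ => pow_nonneg (hl i) _
  have h1 : ‖U * diagonal l * Uᵀ‖ ≤ ‖l‖ := by
    have a1 := l2_opNorm_le_one_of_orthogonal hU'
    have a2 : ‖Uᵀ‖ ≤ 1 := l2_opNorm_le_one_of_orthogonal (by simpa using hU)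
    calc _ ≤ ‖U‖ * ‖diagonal l‖ * ‖Uᵀ‖ :=
          (l2_opNorm_mul _ _).trans (by gcongr; exact l2_opNorm_mul _ _)
      _ ≤ 1 * ‖diagonal l‖ * 1 := by gcongr
      _ = ‖l‖ := by rw [l2_opNorm_diagonal]; ring
  have h2 : ‖l‖ ≤ (∑ i, l i ^ m) ^ (m⁻¹ : ℝ) := by
    refine (pi_norm_le_iff_of_nonneg (by positivity)).2 fun i => ?_
    rw [Real.norm_of_nonneg (hl i)]
    refine (Real.le_rpow_inv_iff_of_pos (hl i) hnn (by positivity)).2 ?_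
    rw [Real.rpow_natCast]
    exact Finset.single_le_sum (f := fun i => l i ^ m) (fun i _ => pow_nonneg (hl i) _)
      (Finset.mem_univ i)
  rw [ht]
  calc _ ≤ ((∑ i, l i ^ m) ^ (m⁻¹ : ℝ)) ^ m := by gcongr; exact h1.trans h2
    _ = _ := Real.rpow_inv_natCast_pow hnn hm

/-- The trace is a sum of the form of `C` at the eigenvectors of `Q`, with nonnegative weights. -/
lemma trace_mul_le_of_form_le {Q C : Matrix n n ℝ} (hQ : Q.PosSemidef) {s : ℝ}
    (hC : ∀ u : n → ℝ, u ⬝ᵥ C *ᵥ u ≤ s * (u ⬝ᵥ u)) : (C * Q).trace ≤ s * Q.trace := by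
  obtain ⟨U, l, hU, hU', hl, rfl⟩ := hQ.exists_orthogonal_diagonalization
  have e : ∀ D : Matrix n n ℝ, (D * (U * diagonal l * Uᵀ)).trace =
      ∑ i, l i * (Uᵀ i ⬝ᵥ D *ᵥ Uᵀ i) := by
    intro D
    rw [← Matrix.mul_assoc, trace_mul_comm, ← Matrix.mul_assoc, ← Matrix.mul_assoc, trace]
    refine Finset.sum_congr rfl fun i _ => ?_
    rw [diag_apply, mul_diagonal, mul_comm]
    congr 1
    rw [Matrix.mul_assoc, mul_apply_eq_vecMul, vecMul, dotProduct, dotProduct]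
    refine Finset.sum_congr rfl fun j _ => ?_
    simp [mul_apply, mulVec, dotProduct]
  have e1 := e 1
  rw [Matrix.one_mul] at e1
  rw [e, e1, Finset.mul_sum]
  refine Finset.sum_le_sum fun i _ => ?_
  have := mul_le_mul_of_nonneg_left (hC (Uᵀ i)) (hl i)
  rw [one_mulVec]
  linarith

end LinearAlgebra

/-! ### Trace moments of sums of independent rank-one matrices -/

section TraceMoment

open Matrix

/-- Bounded measurable real functions. -/
def IsBddMeas {Ω : Type*} [MeasurableSpace Ω] (f : Ω → ℝ) : Prop :=
  Measurable f ∧ ∃ K : ℝ, ∀ ω, |f ω| ≤ K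

namespace IsBddMeas

variable {Ω : Type*} [MeasurableSpace Ω] {f g : Ω → ℝ}

lemma const (c : ℝ) : IsBddMeas (fun _ : Ω => c) := ⟨measurable_const, |c|, fun _ => le_rfl⟩

lemma add (hf : IsBddMeas f) (hg : IsBddMeas g) : IsBddMeas (fun ω => f ω + g ω) := by
  obtain ⟨hf, K, hK⟩ := hf
  obtain ⟨hg, L, hL⟩ := hg
  exact ⟨hf.add hg, K + L, fun ω => (abs_add_le _ _).trans (add_le_add (hK ω) (hL ω))⟩

lemma mul (hf : IsBddMeas f) (hg : IsBddMeas g) : IsBddMeas (fun ω => f ω * g ω) := by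
  obtain ⟨hf, K, hK⟩ := hf
  obtain ⟨hg, L, hL⟩ := hg
  refine ⟨hf.mul hg, K * L, fun ω => ?_⟩
  rw [abs_mul]
  exact mul_le_mul (hK ω) (hL ω) (abs_nonneg _) ((abs_nonneg _).trans (hK ω))

lemma sum {ι : Type*} {s : Finset ι} {f : ι → Ω → ℝ} (hf : ∀ i ∈ s, IsBddMeas (f i)) :
    IsBddMeas (fun ω => ∑ i ∈ s, f i ω) := by
  classical
  induction s using Finset.induction_on with
  | empty => simpa using const (Ω := Ω) 0
  | insert a s ha ih =>
    simp only [Finset.sum_insert ha]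
    exact (hf a (by simp)).add (ih fun i hi => hf i (by simp [hi]))

lemma integrable (hf : IsBddMeas f) (P : Measure Ω) [IsFiniteMeasure P] : Integrable f P := by
  obtain ⟨hf, K, hK⟩ := hf
  exact Integrable.of_bound hf.aestronglyMeasurable K (Filter.Eventually.of_forall hK)

lemma matrix_mul {n : Type*} [Fintype n] {M N : Ω → Matrix n n ℝ}
    (hM : ∀ i j, IsBddMeas (fun ω => M ω i j)) (hN : ∀ i j, IsBddMeas (fun ω => N ω i j))
    (i j : n) : IsBddMeas (fun ω => (M ω * N ω) i j) := by
  simp only [Matrix.mul_apply]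
  exact sum fun l _ => (hM i l).mul (hN l j)

lemma matrix_pow {n : Type*} [Fintype n] [DecidableEq n] {M : Ω → Matrix n n ℝ}
    (hM : ∀ i j, IsBddMeas (fun ω => M ω i j)) (r : ℕ) (i j : n) :
    IsBddMeas (fun ω => (M ω ^ r) i j) := by
  induction r generalizing i j with
  | zero => simpa using const _
  | succ r ih =>
    simp only [pow_succ]
    exact matrix_mul ih hM i j

end IsBddMeas

variable {Ω ι n : Type*} [MeasurableSpace Ω] [Fintype n] [DecidableEq n]

/-- The sum of the rank-one matrices `Y j (Y j)ᵀ` over `j ∈ s`. -/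
def rankOneSum (Y : ι → Ω → n → ℝ) (s : Finset ι) (ω : Ω) : Matrix n n ℝ :=
  ∑ j ∈ s, vecMulVec (Y j ω) (Y j ω)

omit [MeasurableSpace Ω] [DecidableEq n] in
lemma posSemidef_rankOneSum (Y : ι → Ω → n → ℝ) (s : Finset ι) (ω : Ω) :
    (rankOneSum Y s ω).PosSemidef :=
  Matrix.posSemidef_sum s fun j _ => posSemidef_vecMulVec_self (Y j ω)

omit [MeasurableSpace Ω] in
lemma posSemidef_rankOneSum_shift (Y : ι → Ω → n → ℝ) (s : Finset ι) (ω : Ω) {t : ℝ} (ht : 0 ≤ t) :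
    (rankOneSum Y s ω + t • (1 : Matrix n n ℝ)).PosSemidef :=
  (posSemidef_rankOneSum Y s ω).add (posSemidef_smul_one ht)

omit [DecidableEq n] in
lemma isBddMeas_of_dotProduct_self_le {f : Ω → n → ℝ} (hf : Measurable f) {R : ℝ}
    (hR : ∀ ω, f ω ⬝ᵥ f ω ≤ R) (i : n) : IsBddMeas (fun ω => f ω i) := by
  refine ⟨(measurable_pi_apply i).comp hf, √R, fun ω => Real.abs_le_sqrt ?_⟩
  refine le_trans ?_ (hR ω)
  rw [sq]
  exact Finset.single_le_sum (f := fun i => f ω i * f ω i) (fun i _ => mul_self_nonneg _)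
    (Finset.mem_univ i)

lemma isBddMeas_rankOneSum_shift_pow {Y : ι → Ω → n → ℝ} (hY : ∀ j, Measurable (Y j)) {R : ℝ}
    (hR : ∀ j ω, Y j ω ⬝ᵥ Y j ω ≤ R) (s : Finset ι) (t : ℝ) (r : ℕ) (k l : n) :
    IsBddMeas (fun ω => ((rankOneSum Y s ω + t • (1 : Matrix n n ℝ)) ^ r) k l) := by
  refine IsBddMeas.matrix_pow (fun k l => ?_) r k l
  simp only [rankOneSum, Matrix.add_apply, Matrix.sum_apply, vecMulVec_apply]
  exact (IsBddMeas.sum fun j _ => (isBddMeas_of_dotProduct_self_le (hY j) (hR j) k).mul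
    (isBddMeas_of_dotProduct_self_le (hY j) (hR j) l)).add (IsBddMeas.const _)

omit [DecidableEq n] in
lemma dotProduct_mulVec_eq_sum (Q : Matrix n n ℝ) (y : n → ℝ) :
    y ⬝ᵥ Q *ᵥ y = ∑ k, ∑ l, (y l * y k) * Q k l := by
  simp only [dotProduct, mulVec, Finset.mul_sum]
  exact Finset.sum_congr rfl fun k _ => Finset.sum_congr rfl fun l _ => by ring

/-- The expectation of a random quadratic form at an independent vector whose second moments are
bounded by `σ`. -/
lemma integral_form_le_of_indepFun {P : Measure Ω} [IsProbabilityMeasure P] {f : Ω → n → ℝ}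
    (hf : Measurable f) {R σ : ℝ} (hR : ∀ ω, f ω ⬝ᵥ f ω ≤ R)
    (hσ : ∀ u : n → ℝ, ∫ ω, (u ⬝ᵥ f ω) ^ 2 ∂P ≤ σ * (u ⬝ᵥ u))
    {Q : Ω → Matrix n n ℝ} (hQ : ∀ ω, (Q ω).PosSemidef)
    (hQb : ∀ k l, IsBddMeas (fun ω => Q ω k l)) (hind : ∀ k l, IndepFun f (fun ω => Q ω k l) P) :
    ∫ ω, f ω ⬝ᵥ Q ω *ᵥ f ω ∂P ≤ σ * ∫ ω, (Q ω).trace ∂P := by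
  have hfb := isBddMeas_of_dotProduct_self_le hf hR
  -- By independence the expected form is the trace of the second moment matrix `C` times the mean
  -- `E` of `Q`. The form is linear in `Q`, so independence of `f` from each single entry is enough.
  set C : Matrix n n ℝ := of fun k l => ∫ ω, f ω k * f ω l ∂P with hC
  set E : Matrix n n ℝ := of fun k l => ∫ ω, Q ω k l ∂P with hE
  have form : ∀ (M : Ω → Matrix n n ℝ), (∀ k l, IsBddMeas (fun ω => M ω k l)) → ∀ u : n → ℝ,
      u ⬝ᵥ (of fun k l => ∫ ω, M ω k l ∂P) *ᵥ u = ∫ ω, u ⬝ᵥ M ω *ᵥ u ∂P := by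
    intro M hM u
    simp only [dotProduct_mulVec_eq_sum]
    rw [integral_finsetSum _ fun k _ =>
      (IsBddMeas.sum fun l _ => (IsBddMeas.const (u l * u k)).mul (hM k l)).integrable P]
    refine Finset.sum_congr rfl fun k _ => ?_
    rw [integral_finsetSum _ fun l _ =>
      ((IsBddMeas.const (u l * u k)).mul (hM k l)).integrable P]
    exact Finset.sum_congr rfl fun l _ => by rw [integral_const_mul]; rfl
  have hEpos : E.PosSemidef := by
    refine PosSemidef.of_dotProduct_mulVec_nonneg ?_ fun u => ?_
    · ext k l
      simp only [hE, conjTranspose_apply, of_apply, star_trivial]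
      refine integral_congr_ae (Filter.Eventually.of_forall fun ω => ?_)
      simpa using (hQ ω).1.apply k l
    · rw [star_trivial, hE, form _ hQb]
      exact integral_nonneg fun ω => (hQ ω).dotProduct_self_mulVec_nonneg u
  have hCle : ∀ u : n → ℝ, u ⬝ᵥ C *ᵥ u ≤ σ * (u ⬝ᵥ u) := by
    intro u
    have := form (fun ω => of fun k l => f ω k * f ω l) (fun k l => (hfb k).mul (hfb l)) u
    simp only [of_apply] at this
    rw [hC, this]
    refine le_of_eq_of_le (integral_congr_ae (Filter.Eventually.of_forall fun ω => ?_)) (hσ u)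
    simp only
    rw [dotProduct_mulVec_eq_sum]
    simp only [dotProduct, of_apply, sq, Finset.sum_mul_sum]
    exact Finset.sum_congr rfl fun k _ => Finset.sum_congr rfl fun l _ => by ring
  have h1 : ∫ ω, f ω ⬝ᵥ Q ω *ᵥ f ω ∂P = (C * E).trace := by
    simp only [dotProduct_mulVec_eq_sum]
    have b : ∀ k l, IsBddMeas fun ω => f ω l * f ω k * Q ω k l := fun k l =>
      ((hfb l).mul (hfb k)).mul (hQb k l)
    rw [integral_finsetSum _ fun k _ => (IsBddMeas.sum fun l _ => b k l).integrable P,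
      trace_mul_comm, trace]
    refine Finset.sum_congr rfl fun k _ => ?_
    rw [integral_finsetSum _ fun l _ => (b k l).integrable P, diag_apply, mul_apply]
    refine Finset.sum_congr rfl fun l _ => ?_
    have hi : IndepFun (fun ω => f ω l * f ω k) (fun ω => Q ω k l) P :=
      (hind k l).comp (φ := fun y : n → ℝ => y l * y k) (ψ := id) (by fun_prop) measurable_id
    rw [hi.integral_fun_mul_eq_mul_integral ((hfb l).mul (hfb k)).1.aestronglyMeasurable
      (hQb k l).1.aestronglyMeasurable, hC, hE, of_apply, of_apply, mul_comm]
  have h2 : ∫ ω, (Q ω).trace ∂P = E.trace := by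
    simp only [trace, diag_apply]
    rw [integral_finsetSum _ fun k _ => (hQb k k).integrable P]
    rfl
  rw [h1, h2]
  exact trace_mul_le_of_form_le hEpos hCle

variable [DecidableEq ι]

omit [DecidableEq ι] in
lemma indepFun_rankOneSum_shift_pow {P : Measure Ω} {Y : ι → Ω → n → ℝ}
    (hY : ∀ j, Measurable (Y j)) (hind : iIndepFun Y P) {s : Finset ι} {j : ι} (hj : j ∉ s)
    (t : ℝ) (r : ℕ) (k l : n) :
    IndepFun (Y j) (fun ω => ((rankOneSum Y s ω + t • (1 : Matrix n n ℝ)) ^ r) k l) P := by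
  have h := hind.indepFun_finset {j} s (by simpa using hj) hY
  have hφ : Measurable fun z : ({j} : Finset ι) → n → ℝ => z ⟨j, by simp⟩ := measurable_pi_apply _
  have hψ : Measurable fun z : s → n → ℝ =>
      (((∑ i ∈ s.attach, vecMulVec (z i) (z i)) + t • (1 : Matrix n n ℝ)) ^ r) k l := by
    refine Continuous.measurable ?_
    refine Continuous.matrix_elem (A := fun z : s → n → ℝ =>
      ((∑ i ∈ s.attach, vecMulVec (z i) (z i)) + t • (1 : Matrix n n ℝ)) ^ r) ?_ k l
    refine Continuous.pow (Continuous.add (continuous_finsetSum _ fun i _ => ?_)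
      continuous_const) r
    exact (continuous_apply i).matrix_vecMulVec (continuous_apply i)
  have e : (fun ω => ((rankOneSum Y s ω + t • (1 : Matrix n n ℝ)) ^ r) k l) = (fun z : s → n → ℝ =>
      (((∑ i ∈ s.attach, vecMulVec (z i) (z i)) + t • (1 : Matrix n n ℝ)) ^ r) k l) ∘
        fun ω i => Y i ω := by
    funext ω
    have e : rankOneSum Y s ω = ∑ i ∈ s.attach, vecMulVec (Y i ω) (Y i ω) :=
      (Finset.sum_attach s fun i => vecMulVec (Y i ω) (Y i ω)).symm
    rw [Function.comp_apply, e]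
  rw [e]
  exact h.comp hφ hψ

omit [MeasurableSpace Ω] [DecidableEq ι] in
lemma trace_rankOneSum_shift_pow_succ (Y : ι → Ω → n → ℝ) (s : Finset ι) (ω : Ω) (t : ℝ) (m : ℕ) :
    ((rankOneSum Y s ω + t • (1 : Matrix n n ℝ)) ^ (m + 1)).trace =
      t * ((rankOneSum Y s ω + t • (1 : Matrix n n ℝ)) ^ m).trace +
        ∑ j ∈ s, Y j ω ⬝ᵥ ((rankOneSum Y s ω + t • (1 : Matrix n n ℝ)) ^ m) *ᵥ Y j ω := by
  generalize hQ : (rankOneSum Y s ω + t • (1 : Matrix n n ℝ)) ^ m = Q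
  rw [pow_succ', hQ, Matrix.add_mul, trace_add, add_comm]
  congr 1
  · simp
  · rw [rankOneSum, Finset.sum_mul, trace_sum]
    refine Finset.sum_congr rfl fun j _ => ?_
    rw [trace_mul_comm, mul_vecMulVec, trace_vecMulVec, dotProduct_comm]

/-- Trace moments of a sum of independent bounded rank-one matrices. -/
theorem integral_trace_rankOneSum_shift_pow_le {P : Measure Ω} [IsProbabilityMeasure P]
    {Y : ι → Ω → n → ℝ} (hY : ∀ j, Measurable (Y j)) (hind : iIndepFun Y P) {R σ : ℝ}
    (hR0 : 0 ≤ R) (hσ0 : 0 ≤ σ) (hR : ∀ j ω, Y j ω ⬝ᵥ Y j ω ≤ R)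
    (hσ : ∀ j, ∀ u : n → ℝ, ∫ ω, (u ⬝ᵥ Y j ω) ^ 2 ∂P ≤ σ * (u ⬝ᵥ u)) (m : ℕ)
    (s : Finset ι) {t : ℝ} (ht : 0 ≤ t) :
    ∫ ω, ((rankOneSum Y s ω + t • (1 : Matrix n n ℝ)) ^ m).trace ∂P ≤
      Fintype.card n * ∏ i ∈ Finset.range m, (s.card * σ + t + i * R) := by
  -- Both `s` and `t` vary: leaving out `j` shrinks `s`, and replacing its rank-one term raises `t`
  -- to `t + R`.
  induction m generalizing s t with
  | zero => simp
  | succ m ih =>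
    have hb := fun (s : Finset ι) (t : ℝ) => isBddMeas_rankOneSum_shift_pow hY hR s t m
    have hbt : ∀ (s : Finset ι) (t : ℝ),
        IsBddMeas fun ω => ((rankOneSum Y s ω + t • (1 : Matrix n n ℝ)) ^ m).trace :=
      fun s t => IsBddMeas.sum fun k _ => hb s t k k
    have hfb := fun j => isBddMeas_of_dotProduct_self_le (hY j) (hR j)
    have hbf : ∀ (s : Finset ι) (t : ℝ) (j : ι), IsBddMeas fun ω =>
        Y j ω ⬝ᵥ ((rankOneSum Y s ω + t • (1 : Matrix n n ℝ)) ^ m) *ᵥ Y j ω := by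
      intro s t j
      simp only [dotProduct_mulVec_eq_sum]
      exact IsBddMeas.sum fun k _ => IsBddMeas.sum fun l _ =>
        ((hfb j l).mul (hfb j k)).mul (hb s t k l)
    simp only [trace_rankOneSum_shift_pow_succ]
    rw [integral_add (((IsBddMeas.const t).mul (hbt s t)).integrable P)
      ((IsBddMeas.sum fun j _ => hbf s t j).integrable P), integral_const_mul,
      integral_finsetSum _ fun j _ => (hbf s t j).integrable P]
    set N : ℝ := (Fintype.card n : ℝ)
    have hN : 0 ≤ N := Nat.cast_nonneg _
    -- The product with indices moved up by one: the shift `t + R` turns factor `i` into factor `i +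
    -- 1`. The missing factor `s.card * σ + t` comes from the sum of the bounds `t * A` and `σ * A`
    -- per index.
    set A : ℝ := N * ∏ i ∈ Finset.range m, (s.card * σ + t + (i + 1 : ℕ) * R) with hA
    have hA0 : 0 ≤ A := mul_nonneg hN (Finset.prod_nonneg fun i _ => by positivity)
    have h1 : t * ∫ ω, ((rankOneSum Y s ω + t • (1 : Matrix n n ℝ)) ^ m).trace ∂P ≤ t * A := by
      refine mul_le_mul_of_nonneg_left ((ih s ht).trans ?_) ht
      refine mul_le_mul_of_nonneg_left (Finset.prod_le_prod (fun i _ => by positivity)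
        fun i _ => ?_) hN
      push_cast
      nlinarith
    have h2 : ∀ j ∈ s,
        ∫ ω, Y j ω ⬝ᵥ ((rankOneSum Y s ω + t • (1 : Matrix n n ℝ)) ^ m) *ᵥ Y j ω ∂P ≤ σ * A := by
      intro j hj
      have ht' : 0 ≤ t + R := add_nonneg ht hR0
      calc _ ≤ ∫ ω, Y j ω ⬝ᵥ ((rankOneSum Y (s.erase j) ω +
              (t + R) • (1 : Matrix n n ℝ)) ^ m) *ᵥ Y j ω ∂P := by
            refine integral_mono ((hbf s t j).integrable P) ((hbf _ _ j).integrable P) fun ω => ?_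
            have e : rankOneSum Y s ω + t • (1 : Matrix n n ℝ) =
                (rankOneSum Y (s.erase j) ω + t • (1 : Matrix n n ℝ)) +
                  vecMulVec (Y j ω) (Y j ω) := by
              rw [rankOneSum, rankOneSum, ← Finset.sum_erase_add _ _ hj]
              abel
            have h := dotProduct_pow_rankOne_update_le
              (posSemidef_rankOneSum_shift Y (s.erase j) ω ht) (hR j ω) m 0
            simp only [pow_zero, Matrix.one_mul] at h
            simp only
            rw [e, add_smul, ← add_assoc]
            exact h
        _ ≤ σ * ∫ ω, ((rankOneSum Y (s.erase j) ω + (t + R) • (1 : Matrix n n ℝ)) ^ m).trace ∂P :=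
            integral_form_le_of_indepFun (hY j) (hR j) (hσ j)
              (fun ω => (posSemidef_rankOneSum_shift Y _ ω ht').pow m) (hb _ _)
              (indepFun_rankOneSum_shift_pow hY hind (Finset.notMem_erase j s) _ _)
        _ ≤ σ * A := by
            refine mul_le_mul_of_nonneg_left ((ih _ ht').trans ?_) hσ0
            refine mul_le_mul_of_nonneg_left (Finset.prod_le_prod (fun i _ => by positivity)
              fun i _ => ?_) hN
            have hc : ((s.erase j).card : ℝ) ≤ s.card := by
              exact_mod_cast Finset.card_le_card (Finset.erase_subset j s)
            push_cast
            nlinarith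
    refine (add_le_add h1 (Finset.sum_le_sum h2)).trans (le_of_eq ?_)
    rw [Finset.prod_range_succ', Finset.sum_const, hA]
    simp only [nsmul_eq_mul, Nat.cast_zero, zero_mul]
    ring

theorem integral_trace_rankOneSum_pow_le {P : Measure Ω} [IsProbabilityMeasure P]
    {Y : ι → Ω → n → ℝ} (hY : ∀ j, Measurable (Y j)) (hind : iIndepFun Y P) {R σ : ℝ}
    (hR0 : 0 ≤ R) (hσ0 : 0 ≤ σ) (hR : ∀ j ω, Y j ω ⬝ᵥ Y j ω ≤ R)
    (hσ : ∀ j, ∀ u : n → ℝ, ∫ ω, (u ⬝ᵥ Y j ω) ^ 2 ∂P ≤ σ * (u ⬝ᵥ u)) (m : ℕ) (s : Finset ι) :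
    ∫ ω, (rankOneSum Y s ω ^ m).trace ∂P ≤ Fintype.card n * (s.card * σ + m * R) ^ m := by
  have h := integral_trace_rankOneSum_shift_pow_le hY hind hR0 hσ0 hR hσ m s le_rfl
  simp only [zero_smul, add_zero] at h
  refine h.trans (mul_le_mul_of_nonneg_left ?_ (Nat.cast_nonneg _))
  have h2 : (s.card * σ + m * R) ^ m = ∏ _i ∈ Finset.range m, (s.card * σ + m * R) := by simp
  rw [h2]
  refine Finset.prod_le_prod (fun i _ => by positivity) fun i hi => ?_
  have : (i : ℝ) ≤ m := by exact_mod_cast (Finset.mem_range.1 hi).le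
  gcongr

/-- The lower integral version of the trace moment bound, for the spectral norm. -/
theorem lintegral_norm_rankOneSum_pow_le {P : Measure Ω} [IsProbabilityMeasure P]
    {Y : ι → Ω → n → ℝ} (hY : ∀ j, Measurable (Y j)) (hind : iIndepFun Y P) {R σ : ℝ}
    (hR0 : 0 ≤ R) (hσ0 : 0 ≤ σ) (hR : ∀ j ω, Y j ω ⬝ᵥ Y j ω ≤ R)
    (hσ : ∀ j, ∀ u : n → ℝ, ∫ ω, (u ⬝ᵥ Y j ω) ^ 2 ∂P ≤ σ * (u ⬝ᵥ u)) {m : ℕ} (hm : m ≠ 0)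
    (s : Finset ι) :
    ∫⁻ ω, ENNReal.ofReal (‖rankOneSum Y s ω‖ ^ m) ∂P ≤
      ENNReal.ofReal (Fintype.card n * (s.card * σ + m * R) ^ m) := by
  have hb : IsBddMeas fun ω => (rankOneSum Y s ω ^ m).trace := by
    have := fun k => isBddMeas_rankOneSum_shift_pow hY hR s 0 m k k
    simp only [zero_smul, add_zero] at this
    exact IsBddMeas.sum fun k _ => this k
  have hle : ∀ ω, ‖rankOneSum Y s ω‖ ^ m ≤ (rankOneSum Y s ω ^ m).trace := fun ω =>
    (posSemidef_rankOneSum Y s ω).norm_pow_le_trace_pow hm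
  calc _ ≤ ∫⁻ ω, ENNReal.ofReal ((rankOneSum Y s ω ^ m).trace) ∂P :=
        lintegral_mono fun ω => ENNReal.ofReal_le_ofReal (hle ω)
    _ = ENNReal.ofReal (∫ ω, (rankOneSum Y s ω ^ m).trace ∂P) :=
        (ofReal_integral_eq_lintegral_ofReal (hb.integrable P)
          (Filter.Eventually.of_forall fun ω => (pow_nonneg (norm_nonneg _) m).trans (hle ω))).symm
    _ ≤ _ := ENNReal.ofReal_le_ofReal
        (integral_trace_rankOneSum_pow_le hY hind hR0 hσ0 hR hσ m s)

end TraceMoment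

/-! ### Removing the boundedness assumption by truncation -/

section Truncation

open Matrix

variable {V n ι : Type*} [MeasurableSpace V] [Fintype n] [DecidableEq n] [Fintype ι]

omit [DecidableEq n] in
lemma measurable_dotProduct {f g : V → n → ℝ} (hf : Measurable f) (hg : Measurable g) :
    Measurable fun v => f v ⬝ᵥ g v :=
  Finset.measurable_sum _ fun i _ =>
    ((measurable_pi_apply i).comp hf).mul ((measurable_pi_apply i).comp hg)

/-- Spectral norm moments of a sum of independent rank-one matrices, on the event that all the
vectors are bounded. -/
theorem lintegral_indicator_norm_sum_vecMulVec_le {ν : Measure V} [IsProbabilityMeasure ν]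
    {f : V → n → ℝ} (hf : Measurable f) {R σ : ℝ} (hR0 : 0 ≤ R) (hσ0 : 0 ≤ σ)
    (hint : ∀ u : n → ℝ, Integrable (fun v => (u ⬝ᵥ f v) ^ 2) ν)
    (hσ : ∀ u : n → ℝ, ∫ v, (u ⬝ᵥ f v) ^ 2 ∂ν ≤ σ * (u ⬝ᵥ u)) {m : ℕ} (hm : m ≠ 0) :
    ∫⁻ b : ι → V, {b : ι → V | ∀ j, f (b j) ⬝ᵥ f (b j) ≤ R}.indicator
      (fun b => ENNReal.ofReal (‖∑ j, vecMulVec (f (b j)) (f (b j))‖ ^ m)) b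
        ∂(Measure.pi fun _ => ν) ≤
      ENNReal.ofReal (Fintype.card n * (Fintype.card ι * σ + m * R) ^ m) := by
  classical
  -- Setting long vectors to zero can only lower the second moments, and changes nothing on the
  -- event.
  set g : V → n → ℝ := fun v => if f v ⬝ᵥ f v ≤ R then f v else 0 with hg
  have hgm : Measurable g :=
    Measurable.ite (measurableSet_le (measurable_dotProduct hf hf) measurable_const) hf
      measurable_const
  have hgR : ∀ v, g v ⬝ᵥ g v ≤ R := by
    intro v
    by_cases h : f v ⬝ᵥ f v ≤ R <;> simp [hg, h, hR0]
  have hgσ : ∀ u : n → ℝ, ∫ v, (u ⬝ᵥ g v) ^ 2 ∂ν ≤ σ * (u ⬝ᵥ u) := by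
    intro u
    refine le_trans (integral_mono_of_nonneg (Filter.Eventually.of_forall fun v => sq_nonneg _)
      (hint u) (Filter.Eventually.of_forall fun v => ?_)) (hσ u)
    by_cases h : f v ⬝ᵥ f v ≤ R <;> simp [hg, h, sq_nonneg]
  set Y : ι → (ι → V) → n → ℝ := fun j b => g (b j) with hY
  have hYm : ∀ j, Measurable (Y j) := fun j => hgm.comp (measurable_pi_apply j)
  have hind : iIndepFun Y (Measure.pi fun _ : ι => ν) :=
    iIndepFun_pi (X := fun _ => g) fun _ => hgm.aemeasurable
  have key := lintegral_norm_rankOneSum_pow_le hYm hind hR0 hσ0 (fun j b => hgR (b j))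
    (fun j u => by
      have h := (measurePreserving_eval (fun _ : ι => ν) j).map_eq
      have hm : Measurable fun v => (u ⬝ᵥ g v) ^ 2 :=
        (measurable_dotProduct measurable_const hgm).pow_const 2
      have h2 := integral_map (μ := Measure.pi fun _ : ι => ν) (φ := Function.eval j)
        (measurable_pi_apply j).aemeasurable (f := fun v => (u ⬝ᵥ g v) ^ 2)
        hm.aestronglyMeasurable
      rw [h] at h2
      exact (h2.symm.trans_le (hgσ u))) hm Finset.univ
  refine le_trans (lintegral_mono fun b => ?_) (by simpa only [Finset.card_univ] using key)
  by_cases hb : b ∈ {b : ι → V | ∀ j, f (b j) ⬝ᵥ f (b j) ≤ R}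
  swap
  · rw [Set.indicator_of_notMem hb]; exact bot_le
  rw [Set.indicator_of_mem hb]
  refine ENNReal.ofReal_le_ofReal (le_of_eq ?_)
  congr 2
  refine Finset.sum_congr rfl fun j _ => ?_
  have : g (b j) = f (b j) := if_pos (hb j)
  simp only [hY, this]

end Truncation

/-! ### Decoupled blocks of the Gram matrix -/

section Decoupling

open Matrix

variable {V n κ : Type*} [MeasurableSpace V] [Fintype n] [DecidableEq n] [Fintype κ]
  [DecidableEq κ]

/-- The matrix with rows `x (v i)`, where the rows outside of `S` are replaced by zero. -/
def maskedRows (x : V → n → ℝ) (S : Finset κ) (v : κ → V) : Matrix κ n ℝ :=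
  of fun i p => if i ∈ S then x (v i) p else 0

/-- The block of the Gram matrix of the vectors `x (v i)` with rows in `S` and columns outside. -/
def crossGram (x : V → n → ℝ) (S : Finset κ) (v : κ → V) : Matrix κ κ ℝ :=
  maskedRows x S v * (maskedRows x Sᶜ v)ᵀ

omit [MeasurableSpace V] [DecidableEq n] [Fintype κ] in
lemma maskedRows_mulVec (x : V → n → ℝ) (S : Finset κ) (v : κ → V) (w : n → ℝ) (i : κ) :
    (maskedRows x S v *ᵥ w) i = if i ∈ S then x (v i) ⬝ᵥ w else 0 := by
  by_cases h : i ∈ S <;> simp [maskedRows, mulVec, dotProduct, h]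

omit [MeasurableSpace V] [DecidableEq n] in
lemma crossGram_apply (x : V → n → ℝ) (S : Finset κ) (v : κ → V) (i j : κ) :
    crossGram x S v i j = if i ∈ S ∧ j ∉ S then x (v i) ⬝ᵥ x (v j) else 0 := by
  by_cases h : i ∈ S <;> by_cases h' : j ∈ S <;>
    simp [crossGram, maskedRows, Matrix.mul_apply, dotProduct, h, h']

omit [MeasurableSpace V] [DecidableEq n] in
lemma crossGram_mul_transpose (x : V → n → ℝ) (S : Finset κ) (v : κ → V) :
    crossGram x S v * (crossGram x S v)ᵀ =
      ∑ j : {j // ¬ j ∈ S}, vecMulVec (maskedRows x S v *ᵥ x (v j))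
        (maskedRows x S v *ᵥ x (v j)) := by
  ext i l
  rw [Matrix.mul_apply, Matrix.sum_apply, ← Finset.sum_subtype Sᶜ (fun j => Finset.mem_compl)
    fun j => vecMulVec (maskedRows x S v *ᵥ x (v j)) (maskedRows x S v *ᵥ x (v j)) i l]
  rw [← Finset.sum_subset (Finset.subset_univ Sᶜ)]
  · refine Finset.sum_congr rfl fun j hj => ?_
    have hj' : j ∉ S := Finset.mem_compl.1 hj
    simp [crossGram_apply, vecMulVec_apply, maskedRows_mulVec, hj']
  · intro j _ hj
    have hj' : j ∈ S := by simpa using hj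
    simp [crossGram_apply, hj']

omit [Fintype n] [Fintype κ] [DecidableEq n] in
lemma measurable_maskedRows {x : V → n → ℝ} (hx : Measurable x) (S : Finset κ) (i : κ) (p : n) :
    Measurable fun v : κ → V => maskedRows x S v i p := by
  by_cases h : i ∈ S
  · simp only [maskedRows, of_apply, h, if_true]
    exact (measurable_pi_apply p).comp (hx.comp (measurable_pi_apply i))
  · simp [maskedRows, h]

lemma measurable_l2_opNorm {α l n : Type*} [MeasurableSpace α] [Fintype l] [Fintype n]
    [DecidableEq n] {M : α → Matrix l n ℝ} (hM : ∀ i j, Measurable fun a => M a i j) :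
    Measurable fun a => ‖M a‖ := by
  have h : Continuous fun M : l → n → ℝ => ‖Matrix.of M‖ := continuous_norm (E := Matrix l n ℝ)
  exact h.measurable.comp (measurable_pi_lambda _ fun i => measurable_pi_lambda _ fun j => hM i j)

lemma dotProduct_mulVec_self_le {l n : Type*} [Fintype l] [Fintype n] [DecidableEq n]
    (A : Matrix l n ℝ) (w : n → ℝ) : (A *ᵥ w) ⬝ᵥ (A *ᵥ w) ≤ ‖A‖ ^ 2 * (w ⬝ᵥ w) := by
  have h := l2_opNorm_mulVec A (WithLp.toLp 2 w)
  have h2 := pow_le_pow_left₀ (norm_nonneg _) h 2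
  rw [mul_pow, EuclideanSpace.real_norm_sq_eq, EuclideanSpace.real_norm_sq_eq] at h2
  simpa [dotProduct, sq] using h2

lemma norm_mul_transpose_self {l n : Type*} [Fintype l] [Fintype n] [DecidableEq n]
    [DecidableEq l] (A : Matrix l n ℝ) : ‖A * Aᵀ‖ = ‖A‖ ^ 2 := by
  have h := l2_opNorm_conjTranspose_mul_self Aᴴ
  rw [conjTranspose_conjTranspose, l2_opNorm_conjTranspose] at h
  rw [sq, ← h, conjTranspose_eq_transpose_of_trivial]

lemma l2_opNorm_transpose {l n : Type*} [Fintype l] [Fintype n] [DecidableEq n]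
    [DecidableEq l] (A : Matrix l n ℝ) : ‖Aᵀ‖ = ‖A‖ := by
  rw [← conjTranspose_eq_transpose_of_trivial, l2_opNorm_conjTranspose]

/-- The event on which the rows in `S` have spectral norm at most `√σ` and the columns of
`crossGram x S` have Euclidean norm at most `√R`. -/
def crossGood (x : V → n → ℝ) (S : Finset κ) (σ R : ℝ) : Set (κ → V) :=
  {v | ‖maskedRows x S v‖ ^ 2 ≤ σ ∧
    ∀ j, j ∉ S → (maskedRows x S v *ᵥ x (v j)) ⬝ᵥ (maskedRows x S v *ᵥ x (v j)) ≤ R}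

lemma measurableSet_crossGood {x : V → n → ℝ} (hx : Measurable x) (S : Finset κ) (σ R : ℝ) :
    MeasurableSet (crossGood x S σ R) := by
  refine MeasurableSet.inter
    (measurableSet_le ((measurable_l2_opNorm (measurable_maskedRows hx S)).pow_const 2)
      measurable_const) ?_
  have e : {v : κ → V | ∀ j, j ∉ S →
      (maskedRows x S v *ᵥ x (v j)) ⬝ᵥ (maskedRows x S v *ᵥ x (v j)) ≤ R} =
      ⋂ j, ⋂ (_ : j ∉ S), {v : κ → V |
        (maskedRows x S v *ᵥ x (v j)) ⬝ᵥ (maskedRows x S v *ᵥ x (v j)) ≤ R} := by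
    ext v; simp
  change MeasurableSet {v : κ → V | ∀ j, j ∉ S →
      (maskedRows x S v *ᵥ x (v j)) ⬝ᵥ (maskedRows x S v *ᵥ x (v j)) ≤ R}
  rw [e]
  refine MeasurableSet.iInter fun j => MeasurableSet.iInter fun _ => ?_
  have hm : Measurable fun v : κ → V => maskedRows x S v *ᵥ x (v j) := by
    refine measurable_pi_lambda _ fun i => ?_
    exact Finset.measurable_sum _ fun p _ => (measurable_maskedRows hx S i p).mul
      ((measurable_pi_apply p).comp (hx.comp (measurable_pi_apply j)))
  exact measurableSet_le (measurable_dotProduct hm hm) measurable_const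

omit [DecidableEq n] in
lemma measurable_crossGram {x : V → n → ℝ} (hx : Measurable x) (S : Finset κ) (i j : κ) :
    Measurable fun v : κ → V => crossGram x S v i j := by
  simp only [crossGram, Matrix.mul_apply, transpose_apply]
  exact Finset.measurable_sum _ fun p _ =>
    (measurable_maskedRows hx S i p).mul (measurable_maskedRows hx Sᶜ j p)

/-- Moments of the spectral norm of `crossGram x S` for isotropic independent `x (v i)`. -/
theorem lintegral_indicator_norm_crossGram_le {ν : Measure V} [IsProbabilityMeasure ν]
    {x : V → n → ℝ} (hx : Measurable x)
    (hint : ∀ u : n → ℝ, Integrable (fun v => (u ⬝ᵥ x v) ^ 2) ν)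
    (hiso : ∀ u : n → ℝ, ∫ v, (u ⬝ᵥ x v) ^ 2 ∂ν ≤ u ⬝ᵥ u) {σ R : ℝ} (hσ : 0 ≤ σ) (hR : 0 ≤ R)
    {m : ℕ} (hm : m ≠ 0) (S : Finset κ) :
    ∫⁻ v, (crossGood x S σ R).indicator
        (fun v => ENNReal.ofReal (‖crossGram x S v‖ ^ (2 * m))) v ∂(Measure.pi fun _ : κ => ν) ≤
      ENNReal.ofReal (Fintype.card κ * (Fintype.card κ * σ + m * R) ^ m) := by
  set B := ENNReal.ofReal (Fintype.card κ * (Fintype.card κ * σ + m * R) ^ m) with hB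
  set F : (κ → V) → ENNReal := (crossGood x S σ R).indicator
    (fun v => ENNReal.ofReal (‖crossGram x S v‖ ^ (2 * m))) with hF
  have hFm : Measurable F :=
    (((measurable_l2_opNorm (measurable_crossGram hx S)).pow_const _).ennreal_ofReal).indicator
      (measurableSet_crossGood hx S σ R)
  -- Fubini: the vectors `a` with index in `S` are frozen, and the bound is shown for each `a` over
  -- the remaining ones.
  set e := MeasurableEquiv.piEquivPiSubtypeProd (fun _ : κ => V) (· ∈ S) with he
  have mp := (measurePreserving_piEquivPiSubtypeProd (fun _ : κ => ν) (· ∈ S)).symm e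
  rw [← mp.lintegral_comp hFm, lintegral_prod (fun z => F (e.symm z))
    (hFm.comp e.symm.measurable).aemeasurable]
  suffices h : ∀ a : {i // i ∈ S} → V,
      ∫⁻ b : {i // ¬ i ∈ S} → V, F (e.symm (a, b)) ∂(Measure.pi fun _ => ν) ≤ B by
    refine (lintegral_mono h).trans ?_
    simp
  intro a
  set Z : Matrix κ n ℝ := of fun i p => if h : i ∈ S then x (a ⟨i, h⟩) p else 0 with hZ
  have hv : ∀ (b : {i // ¬ i ∈ S} → V) (j : {i // ¬ i ∈ S}), e.symm (a, b) j = b j := by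
    intro b j
    simp [he, MeasurableEquiv.piEquivPiSubtypeProd, Equiv.piEquivPiSubtypeProd, j.2]
  have hmask : ∀ b, maskedRows x S (e.symm (a, b)) = Z := by
    intro b
    ext i p
    by_cases h : i ∈ S
    · simp [he, hZ, maskedRows, MeasurableEquiv.piEquivPiSubtypeProd, Equiv.piEquivPiSubtypeProd, h]
    · simp [hZ, maskedRows, h]
  by_cases hZσ : ‖Z‖ ^ 2 ≤ σ
  · have hform : ∀ (u : κ → ℝ) (w : V), u ⬝ᵥ (Z *ᵥ x w) = (Zᵀ *ᵥ u) ⬝ᵥ x w := by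
      intro u w
      rw [dotProduct_mulVec, mulVec_transpose]
    have key := lintegral_indicator_norm_sum_vecMulVec_le (ι := {i // ¬ i ∈ S}) (ν := ν)
      (f := fun w => Z *ᵥ x w) (R := R) (σ := σ)
      ((Continuous.matrix_mulVec continuous_const continuous_id).measurable.comp hx) hR hσ
      (fun u => by simp only [hform]; exact hint _)
      (fun u => by
        simp only [hform]
        refine (hiso _).trans ((dotProduct_mulVec_self_le _ _).trans ?_)
        rw [l2_opNorm_transpose]
        exact mul_le_mul_of_nonneg_right hZσ (dotProduct_self_star_nonneg u)) hm
    refine le_trans (lintegral_mono fun b => ?_) (key.trans ?_)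
    · by_cases hb : e.symm (a, b) ∈ crossGood x S σ R
      swap
      · rw [hF, Set.indicator_of_notMem hb]; exact bot_le
      have hb' : b ∈ {b : {i // ¬ i ∈ S} → V | ∀ j, (Z *ᵥ x (b j)) ⬝ᵥ (Z *ᵥ x (b j)) ≤ R} := by
        intro j
        have := hb.2 j j.2
        rwa [hmask, hv] at this
      rw [hF, Set.indicator_of_mem hb, Set.indicator_of_mem hb', pow_mul,
        ← norm_mul_transpose_self, crossGram_mul_transpose]
      simp only [hmask, hv, le_refl]
    · refine ENNReal.ofReal_le_ofReal (mul_le_mul_of_nonneg_left (pow_le_pow_left₀ (by positivity)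
        ?_ _) (Nat.cast_nonneg _))
      have : ((Fintype.card {i // ¬ i ∈ S} : ℕ) : ℝ) ≤ Fintype.card κ := by
        exact_mod_cast Fintype.card_subtype_le _
      gcongr
  -- If the frozen rows are too large, the indicator vanishes for every `b`.
  · refine (lintegral_mono fun b => ?_).trans (lintegral_zero.le.trans bot_le)
    have hb : e.symm (a, b) ∉ crossGood x S σ R := fun hb =>
      hZσ (by simpa only [hmask] using hb.1)
    rw [hF, Set.indicator_of_notMem hb]

end Decoupling

/-! ### From blocks to the off-diagonal part, by averaging over index sets -/

section OffDiagonal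

open Matrix

variable {V n κ : Type*} [MeasurableSpace V] [Fintype n] [DecidableEq n] [Fintype κ]
  [DecidableEq κ]

/-- The off-diagonal part of the Gram matrix of the vectors `x (v i)`. -/
def offGram (x : V → n → ℝ) (v : κ → V) : Matrix κ κ ℝ :=
  of fun i j => if i = j then 0 else x (v i) ⬝ᵥ x (v j)

lemma card_filter_mem_notMem {i j : κ} (hij : i ≠ j) :
    4 * (Finset.univ.filter fun S : Finset κ => i ∈ S ∧ j ∉ S).card = 2 ^ Fintype.card κ := by
  have e : (Finset.univ.filter fun S : Finset κ => i ∈ S ∧ j ∉ S) = Finset.Icc {i} {j}ᶜ := by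
    ext S
    simp [Finset.mem_Icc, Finset.subset_compl_singleton]
  have hsub : ({i} : Finset κ) ⊆ {j}ᶜ := by simpa using hij.symm
  have h2 : 1 < Fintype.card κ := Fintype.one_lt_card_iff.2 ⟨i, j, hij⟩
  rw [e, Finset.card_Icc_finset hsub, Finset.card_compl, Finset.card_singleton,
    Finset.card_singleton]
  obtain ⟨c, hc⟩ := Nat.exists_eq_add_of_le h2
  rw [hc]
  simp only [Nat.succ_eq_add_one]
  rw [show 0 + 1 + 1 + c - 1 - 1 = c by omega, show 0 + 1 + 1 + c = c + 2 by omega, pow_add]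
  ring

omit [MeasurableSpace V] [DecidableEq n] in
lemma sum_crossGram (x : V → n → ℝ) (v : κ → V) :
    (4 : ℝ) • ∑ S : Finset κ, crossGram x S v = (2 : ℝ) ^ Fintype.card κ • offGram x v := by
  ext i j
  rw [Matrix.smul_apply, Matrix.smul_apply, Matrix.sum_apply]
  simp only [crossGram_apply, offGram, of_apply, smul_eq_mul]
  rw [← Finset.sum_filter, Finset.sum_const, nsmul_eq_mul, ← mul_assoc]
  by_cases hij : i = j
  · subst hij; simp
  · rw [if_neg hij]
    congr 1
    exact_mod_cast card_filter_mem_notMem hij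

omit [MeasurableSpace V] [DecidableEq n] in
-- The off-diagonal part is 4 times the uniform average of the blocks over all `S`; the triangle
-- inequality and convexity of the power do the rest.
lemma norm_offGram_pow_le (x : V → n → ℝ) (v : κ → V) (r : ℕ) :
    ‖offGram x v‖ ^ r ≤
      4 ^ r * ∑ S : Finset κ, ((2 : ℝ) ^ Fintype.card κ)⁻¹ * ‖crossGram x S v‖ ^ r := by
  set a : ℝ := ((2 : ℝ) ^ Fintype.card κ)⁻¹ with ha
  have ha0 : 0 < a := by positivity
  have e : offGram x v = (4 : ℝ) • ∑ S : Finset κ, a • crossGram x S v := by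
    rw [← Finset.smul_sum, smul_comm, sum_crossGram, smul_smul, ha, inv_mul_cancel₀ (by positivity),
      one_smul]
  have h1 : ‖offGram x v‖ ≤ 4 * ∑ S : Finset κ, a * ‖crossGram x S v‖ := by
    rw [e, norm_smul, Real.norm_of_nonneg (by norm_num)]
    gcongr
    refine (norm_sum_le _ _).trans (Finset.sum_le_sum fun S _ => ?_)
    rw [norm_smul, Real.norm_of_nonneg ha0.le]
  calc _ ≤ (4 * ∑ S : Finset κ, a * ‖crossGram x S v‖) ^ r := by gcongr
    _ = 4 ^ r * (∑ S : Finset κ, a * ‖crossGram x S v‖) ^ r := mul_pow _ _ _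
    _ ≤ _ := by
      gcongr
      refine Real.pow_arith_mean_le_arith_mean_pow _ _ _ (fun _ _ => ha0.le) ?_
        (fun _ _ => norm_nonneg _) r
      simp [ha]

omit [DecidableEq n] [Fintype κ] in
lemma measurable_offGram {x : V → n → ℝ} (hx : Measurable x) (i j : κ) :
    Measurable fun v : κ → V => offGram x v i j := by
  by_cases h : i = j
  · simp [offGram, h]
  · simp only [offGram, of_apply, h, if_false]
    exact measurable_dotProduct (hx.comp (measurable_pi_apply i)) (hx.comp (measurable_pi_apply j))

/-- The event on which all the vectors jointly have spectral norm at most `√σ` and the rows of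
the off-diagonal part of the Gram matrix have Euclidean norm at most `√R`. -/
def offGood (x : V → n → ℝ) (σ R : ℝ) : Set (κ → V) :=
  {v | ‖maskedRows x Finset.univ v‖ ^ 2 ≤ σ ∧ ∀ j, ∑ i, offGram x v i j ^ 2 ≤ R}

lemma measurableSet_offGood {x : V → n → ℝ} (hx : Measurable x) (σ R : ℝ) :
    MeasurableSet (offGood (κ := κ) x σ R) := by
  refine MeasurableSet.inter
    (measurableSet_le ((measurable_l2_opNorm (measurable_maskedRows hx _)).pow_const 2)
      measurable_const) ?_
  have e : {v : κ → V | ∀ j, ∑ i, offGram x v i j ^ 2 ≤ R} =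
      ⋂ j, {v : κ → V | ∑ i, offGram x v i j ^ 2 ≤ R} := by
    ext v; simp
  change MeasurableSet {v : κ → V | ∀ j, ∑ i, offGram x v i j ^ 2 ≤ R}
  rw [e]
  exact MeasurableSet.iInter fun j => measurableSet_le
    (Finset.measurable_sum _ fun i _ => (measurable_offGram hx i j).pow_const 2) measurable_const

lemma l2_opNorm_diagonal_indicator_le_one (S : Finset κ) :
    ‖(diagonal fun i => if i ∈ S then (1 : ℝ) else 0)‖ ≤ 1 := by
  rw [l2_opNorm_diagonal]
  refine (pi_norm_le_iff_of_nonneg zero_le_one).2 fun i => ?_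
  by_cases h : i ∈ S <;> simp [h]

omit [MeasurableSpace V] in
lemma norm_maskedRows_le (x : V → n → ℝ) (S : Finset κ) (v : κ → V) :
    ‖maskedRows x S v‖ ≤ ‖maskedRows x Finset.univ v‖ := by
  have e : maskedRows x S v =
      (diagonal fun i => if i ∈ S then (1 : ℝ) else 0) * maskedRows x Finset.univ v := by
    ext i p
    by_cases h : i ∈ S <;> simp [maskedRows, diagonal_mul, h]
  rw [e]
  refine (l2_opNorm_mul _ _).trans ?_
  exact mul_le_of_le_one_left (norm_nonneg _) (l2_opNorm_diagonal_indicator_le_one S)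

omit [MeasurableSpace V] in
-- Dropping rows or entries only decreases the norms, so one event that does not depend on `S`
-- serves all blocks.
lemma offGood_subset_crossGood (x : V → n → ℝ) (σ R : ℝ) (S : Finset κ) :
    offGood x σ R ⊆ crossGood x S σ R := by
  intro v hv
  refine ⟨le_trans (pow_le_pow_left₀ (norm_nonneg _) (norm_maskedRows_le x S v) 2) hv.1,
    fun j hj => le_trans ?_ (hv.2 j)⟩
  rw [dotProduct]
  refine Finset.sum_le_sum fun i _ => ?_
  rw [maskedRows_mulVec]
  by_cases hi : i ∈ S
  · have hij : i ≠ j := fun h => hj (h ▸ hi)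
    simp [hi, offGram, hij, sq]
  · simp [hi, sq_nonneg]

variable {ν : Measure V} [IsProbabilityMeasure ν]

theorem lintegral_indicator_norm_offGram_le {x : V → n → ℝ} (hx : Measurable x)
    (hint : ∀ u : n → ℝ, Integrable (fun v => (u ⬝ᵥ x v) ^ 2) ν)
    (hiso : ∀ u : n → ℝ, ∫ v, (u ⬝ᵥ x v) ^ 2 ∂ν ≤ u ⬝ᵥ u) {σ R : ℝ} (hσ : 0 ≤ σ) (hR : 0 ≤ R)
    {m : ℕ} (hm : m ≠ 0) :
    ∫⁻ v, (offGood x σ R).indicator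
        (fun v => ENNReal.ofReal (‖offGram x v‖ ^ (2 * m))) v ∂(Measure.pi fun _ : κ => ν) ≤
      ENNReal.ofReal (Fintype.card κ * (16 * (Fintype.card κ * σ + m * R)) ^ m) := by
  set B : ℝ := Fintype.card κ * (Fintype.card κ * σ + m * R) ^ m with hB
  have hB0 : 0 ≤ B := by positivity
  set a : ℝ := ((2 : ℝ) ^ Fintype.card κ)⁻¹ with ha
  have ha0 : 0 < a := by positivity
  set F : Finset κ → (κ → V) → ENNReal := fun S => (crossGood x S σ R).indicator
    (fun v => ENNReal.ofReal (‖crossGram x S v‖ ^ (2 * m))) with hF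
  have hFm : ∀ S, Measurable (F S) := fun S =>
    (((measurable_l2_opNorm (measurable_crossGram hx S)).pow_const _).ennreal_ofReal).indicator
      (measurableSet_crossGood hx S σ R)
  have hle : ∀ v, (offGood x σ R).indicator
      (fun v => ENNReal.ofReal (‖offGram x v‖ ^ (2 * m))) v ≤
      ENNReal.ofReal (4 ^ (2 * m)) * ∑ S : Finset κ, ENNReal.ofReal a * F S v := by
    intro v
    by_cases hv : v ∈ offGood x σ R
    swap
    · rw [Set.indicator_of_notMem hv]; exact bot_le
    have hFv : ∀ S, F S v = ENNReal.ofReal (‖crossGram x S v‖ ^ (2 * m)) := fun S =>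
      Set.indicator_of_mem (offGood_subset_crossGood x σ R S hv) _
    rw [Set.indicator_of_mem hv]
    refine (ENNReal.ofReal_le_ofReal (norm_offGram_pow_le x v (2 * m))).trans (le_of_eq ?_)
    rw [ENNReal.ofReal_mul (by positivity), ENNReal.ofReal_sum_of_nonneg fun S _ => by positivity]
    congr 1
    exact Finset.sum_congr rfl fun S _ => by rw [ENNReal.ofReal_mul ha0.le, hFv]
  refine (lintegral_mono hle).trans ?_
  rw [lintegral_const_mul _ (Finset.measurable_sum _ fun S _ => (hFm S).const_mul _),
    lintegral_finsetSum _ fun S _ => (hFm S).const_mul _]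
  calc _ ≤ ENNReal.ofReal (4 ^ (2 * m)) * ∑ S : Finset κ, ENNReal.ofReal a * ENNReal.ofReal B := by
        gcongr with S
        rw [lintegral_const_mul _ (hFm S)]
        gcongr
        exact lintegral_indicator_norm_crossGram_le hx hint hiso hσ hR hm S
    _ = ENNReal.ofReal (4 ^ (2 * m) * (∑ _S : Finset κ, a * B)) := by
        simp only [← ENNReal.ofReal_mul ha0.le]
        rw [← ENNReal.ofReal_sum_of_nonneg fun S _ => mul_nonneg ha0.le hB0,
          ← ENNReal.ofReal_mul (by positivity)]
    _ = _ := by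
        congr 1
        rw [Finset.sum_const, Finset.card_univ, Fintype.card_finset, nsmul_eq_mul, ha]
        push_cast
        rw [mul_inv_cancel_left₀ (by positivity), hB, mul_pow, pow_mul]
        norm_num
        ring

/-- Markov's inequality for a function restricted to an event. -/
lemma measure_inter_lt_le {Ω : Type*} [MeasurableSpace Ω] {P : Measure Ω} {G : Set Ω}
    (hG : MeasurableSet G) {f : Ω → ℝ} (hf : Measurable f) {T A q : ℝ}
    (hT : 0 ≤ T) (hA : A ≤ q * T)
    (h : ∫⁻ ω, G.indicator (fun ω => ENNReal.ofReal (f ω)) ω ∂P ≤ ENNReal.ofReal A) :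
    P (G ∩ {ω | T < f ω}) ≤ ENNReal.ofReal q := by
  -- For `T = 0` the integral vanishes, so `f` is positive only on a null part of `G`.
  rcases hT.eq_or_lt with rfl | hT
  · have h0 : ∫⁻ ω, G.indicator (fun ω => ENNReal.ofReal (f ω)) ω ∂P = 0 := by
      refine le_antisymm (h.trans ?_) bot_le
      rw [ENNReal.ofReal_eq_zero.2 (by linarith)]
    rw [lintegral_eq_zero_iff (hf.ennreal_ofReal.indicator hG)] at h0
    have : P (G ∩ {ω | 0 < f ω}) = 0 := by
      refine measure_mono_null (fun ω hω => ?_) (ae_iff.1 h0)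
      simpa [hω.1] using hω.2
    rw [this]; exact bot_le
  have hm := mul_meas_ge_le_lintegral (μ := P) (hf.ennreal_ofReal.indicator hG) (ENNReal.ofReal T)
  have hsub : G ∩ {ω | T < f ω} ⊆
      {ω | ENNReal.ofReal T ≤ G.indicator (fun ω => ENNReal.ofReal (f ω)) ω} := by
    intro ω hω
    change ENNReal.ofReal T ≤ G.indicator (fun ω => ENNReal.ofReal (f ω)) ω
    rw [Set.indicator_of_mem hω.1]
    exact ENNReal.ofReal_le_ofReal (le_of_lt hω.2)
  have hT0 : ENNReal.ofReal T ≠ 0 := by simpa using hT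
  have h3 : ENNReal.ofReal T * P (G ∩ {ω | T < f ω}) ≤ ENNReal.ofReal T * ENNReal.ofReal q := by
    rw [← ENNReal.ofReal_mul hT.le, mul_comm T q]
    exact (mul_le_mul_right (measure_mono hsub) _).trans
      (hm.trans (h.trans (ENNReal.ofReal_le_ofReal hA)))
  exact (ENNReal.mul_le_mul_iff_right hT0 ENNReal.ofReal_ne_top).1 h3

end OffDiagonal

/-! ### Tail bounds for Gram matrices of isotropic vectors -/

section IsotropicGram

open Matrix

variable {V n κ : Type*} [MeasurableSpace V] [Fintype n] [DecidableEq n] [Fintype κ]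
  [DecidableEq κ]

omit [MeasurableSpace V] [Fintype n] [DecidableEq n] in
lemma sum_vecMulVec_eq_transpose_mul (x : V → n → ℝ) (v : κ → V) :
    ∑ j, vecMulVec (x (v j)) (x (v j)) =
      (maskedRows x Finset.univ v)ᵀ * maskedRows x Finset.univ v := by
  ext p q
  simp [Matrix.sum_apply, Matrix.mul_apply, maskedRows, vecMulVec_apply]

omit [MeasurableSpace V] in
lemma norm_sum_vecMulVec (x : V → n → ℝ) (v : κ → V) :
    ‖∑ j, vecMulVec (x (v j)) (x (v j))‖ = ‖maskedRows x Finset.univ v‖ ^ 2 := by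
  rw [sum_vecMulVec_eq_transpose_mul, ← l2_opNorm_transpose (maskedRows x Finset.univ v),
    ← norm_mul_transpose_self, transpose_transpose]

omit [MeasurableSpace V] in
lemma norm_maskedRows_singleton_sq_le (x : V → n → ℝ) (v : κ → V) (j : κ) :
    ‖maskedRows x {j} v‖ ^ 2 ≤ x (v j) ⬝ᵥ x (v j) := by
  have e : maskedRows x {j} v * (maskedRows x {j} v)ᵀ =
      diagonal (Pi.single j (x (v j) ⬝ᵥ x (v j))) := by
    ext i l
    by_cases hi : i = j <;> by_cases hl : l = j <;> by_cases hil : i = l <;>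
      simp_all [maskedRows, Matrix.mul_apply, dotProduct]
  rw [← norm_mul_transpose_self, e, l2_opNorm_diagonal]
  have h0 : 0 ≤ x (v j) ⬝ᵥ x (v j) := dotProduct_self_star_nonneg (x (v j))
  refine (pi_norm_le_iff_of_nonneg h0).2 fun i => ?_
  by_cases hi : i = j
  · subst hi; simp [abs_of_nonneg h0]
  · simp [hi, h0]

omit [MeasurableSpace V] [DecidableEq n] in
lemma sum_offGram_sq_le (x : V → n → ℝ) (v : κ → V) (j : κ) :
    ∑ i, offGram x v i j ^ 2 ≤ ‖crossGram x {j} v‖ ^ 2 := by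
  have h := dotProduct_mulVec_self_le (crossGram x {j} v)ᵀ (Pi.single j 1)
  rw [l2_opNorm_transpose] at h
  refine le_trans (le_of_eq ?_) (h.trans (by simp))
  rw [dotProduct]
  refine Finset.sum_congr rfl fun i _ => ?_
  rw [mulVec_single_one, col_apply, transpose_apply, crossGram_apply, offGram, of_apply, sq]
  by_cases hij : i = j <;> simp [hij, dotProduct_comm (x (v i))]

omit [MeasurableSpace V] in
-- For `S = {j}` the block has the single row `j`, so each column bound concerns one inner product.
lemma mem_crossGood_singleton {x : V → n → ℝ} {v : κ → V} {j : κ} {r R : ℝ}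
    (h1 : x (v j) ⬝ᵥ x (v j) ≤ r) (h2 : ∀ i, i ≠ j → (x (v j) ⬝ᵥ x (v i)) ^ 2 ≤ R) :
    v ∈ crossGood x {j} r R := by
  refine ⟨(norm_maskedRows_singleton_sq_le x v j).trans h1, fun i hi => ?_⟩
  refine le_trans (le_of_eq ?_) (h2 i (by simpa using hi))
  rw [dotProduct, Finset.sum_eq_single j]
  · simp [maskedRows_mulVec, sq]
  · intro l _ hl
    simp [maskedRows_mulVec, hl]
  · simp

variable {ν : Measure V} [IsProbabilityMeasure ν]

lemma measure_norm_maskedRows_gt_le {x : V → n → ℝ} (hx : Measurable x)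
    (hint : ∀ u : n → ℝ, Integrable (fun v => (u ⬝ᵥ x v) ^ 2) ν)
    (hiso : ∀ u : n → ℝ, ∫ v, (u ⬝ᵥ x v) ^ 2 ∂ν ≤ u ⬝ᵥ u) {r E : ℝ} (hr : 0 ≤ r)
    (hE : 0 < E) {m : ℕ} (hm : m ≠ 0) :
    (Measure.pi fun _ : κ => ν) ({v | ∀ j, x (v j) ⬝ᵥ x (v j) ≤ r} ∩
      {v | E * (Fintype.card κ + m * r) < ‖maskedRows x Finset.univ v‖ ^ 2}) ≤
      ENNReal.ofReal (Fintype.card n * E⁻¹ ^ m) := by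
  have key := lintegral_indicator_norm_sum_vecMulVec_le (ι := κ) hx hr zero_le_one hint
    (fun u => by simpa using hiso u) hm
  simp only [mul_one, norm_sum_vecMulVec] at key
  have hG : MeasurableSet {v : κ → V | ∀ j, x (v j) ⬝ᵥ x (v j) ≤ r} := by
    have e : {v : κ → V | ∀ j, x (v j) ⬝ᵥ x (v j) ≤ r} =
        ⋂ j, {v : κ → V | x (v j) ⬝ᵥ x (v j) ≤ r} := by ext v; simp
    rw [e]
    exact MeasurableSet.iInter fun j => measurableSet_le
      (measurable_dotProduct (hx.comp (measurable_pi_apply j)) (hx.comp (measurable_pi_apply j)))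
      measurable_const
  refine le_trans (measure_mono ?_) (measure_inter_lt_le hG
    (((measurable_l2_opNorm (measurable_maskedRows hx Finset.univ)).pow_const 2).pow_const m)
    (T := (E * (Fintype.card κ + m * r)) ^ m) (by positivity)
    (q := Fintype.card n * E⁻¹ ^ m) (le_of_eq ?_) key)
  · refine Set.inter_subset_inter_right _ fun v hv => ?_
    rw [Set.mem_ofPred_eq] at hv ⊢
    exact pow_lt_pow_left₀ hv (by positivity) hm
  · rw [mul_pow E, mul_assoc, ← mul_assoc (E⁻¹ ^ m), ← mul_pow, inv_mul_cancel₀ hE.ne']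
    simp

/-- Applied with `S = {j}`, the decoupled bound controls one row of the off-diagonal part; this
supplies the column bound needed for general `S`. -/
lemma measure_sum_offGram_sq_gt_le {x : V → n → ℝ} (hx : Measurable x)
    (hint : ∀ u : n → ℝ, Integrable (fun v => (u ⬝ᵥ x v) ^ 2) ν)
    (hiso : ∀ u : n → ℝ, ∫ v, (u ⬝ᵥ x v) ^ 2 ∂ν ≤ u ⬝ᵥ u) {σ R E : ℝ} (hσ : 0 ≤ σ) (hR : 0 ≤ R)
    (hE : 0 < E) {m : ℕ} (hm : m ≠ 0) (j : κ) :
    (Measure.pi fun _ : κ => ν) (crossGood x {j} σ R ∩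
      {v | E * (Fintype.card κ * σ + m * R) < ∑ i, offGram x v i j ^ 2}) ≤
      ENNReal.ofReal (Fintype.card κ * E⁻¹ ^ m) := by
  have key := lintegral_indicator_norm_crossGram_le (κ := κ) hx hint hiso hσ hR hm {j}
  simp only [pow_mul] at key
  refine le_trans (measure_mono ?_) (measure_inter_lt_le (measurableSet_crossGood hx {j} σ R)
    (((measurable_l2_opNorm (measurable_crossGram hx {j})).pow_const 2).pow_const m)
    (T := (E * (Fintype.card κ * σ + m * R)) ^ m) (by positivity)
    (q := Fintype.card κ * E⁻¹ ^ m) (le_of_eq ?_) key)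
  · exact Set.inter_subset_inter_right _ fun v hv =>
      pow_lt_pow_left₀ (lt_of_lt_of_le hv (sum_offGram_sq_le x v j)) (by positivity) hm
  · rw [mul_pow E, mul_assoc, ← mul_assoc (E⁻¹ ^ m), ← mul_pow, inv_mul_cancel₀ hE.ne']
    simp

lemma measure_norm_offGram_sq_gt_le {x : V → n → ℝ} (hx : Measurable x)
    (hint : ∀ u : n → ℝ, Integrable (fun v => (u ⬝ᵥ x v) ^ 2) ν)
    (hiso : ∀ u : n → ℝ, ∫ v, (u ⬝ᵥ x v) ^ 2 ∂ν ≤ u ⬝ᵥ u) {σ R E : ℝ} (hσ : 0 ≤ σ) (hR : 0 ≤ R)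
    (hE : 0 < E) {m : ℕ} (hm : m ≠ 0) :
    (Measure.pi fun _ : κ => ν) (offGood x σ R ∩
      {v | E * (16 * (Fintype.card κ * σ + m * R)) < ‖offGram x v‖ ^ 2}) ≤
      ENNReal.ofReal (Fintype.card κ * E⁻¹ ^ m) := by
  have key := lintegral_indicator_norm_offGram_le (κ := κ) hx hint hiso hσ hR hm
  simp only [pow_mul] at key
  refine le_trans (measure_mono ?_) (measure_inter_lt_le (measurableSet_offGood hx σ R)
    (((measurable_l2_opNorm (measurable_offGram hx)).pow_const 2).pow_const m)
    (T := (E * (16 * (Fintype.card κ * σ + m * R))) ^ m) (by positivity)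
    (q := Fintype.card κ * E⁻¹ ^ m) (le_of_eq ?_) key)
  · refine Set.inter_subset_inter_right _ fun v hv => ?_
    rw [Set.mem_ofPred_eq] at hv ⊢
    exact pow_lt_pow_left₀ hv (by positivity) hm
  · rw [mul_pow E, mul_assoc, ← mul_assoc (E⁻¹ ^ m), ← mul_pow, inv_mul_cancel₀ hE.ne']
    simp

/-- The spectral norm of the off-diagonal part of the Gram matrix of independent isotropic
vectors with `‖x‖² ≤ r` and `⟪x, x'⟫² ≤ L r` outside of small events. -/
theorem measure_norm_offGram_gt_le {x : V → n → ℝ} (hx : Measurable x)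
    (hint : ∀ u : n → ℝ, Integrable (fun v => (u ⬝ᵥ x v) ^ 2) ν)
    (hiso : ∀ u : n → ℝ, ∫ v, (u ⬝ᵥ x v) ^ 2 ∂ν ≤ u ⬝ᵥ u) {r L E : ℝ} (hr : 0 ≤ r) (hL : 0 ≤ L)
    (hE : 0 < E) {m : ℕ} (hm : m ≠ 0) :
    (Measure.pi fun _ : κ => ν) {v |
        E * (16 * (Fintype.card κ * (E * (Fintype.card κ + m * r)) +
          m * (E * (Fintype.card κ * r + m * (L * r))))) < ‖offGram x v‖ ^ 2} ≤
      (Measure.pi fun _ : κ => ν) {v | ∃ j, r < x (v j) ⬝ᵥ x (v j)} +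
      (Measure.pi fun _ : κ => ν) {v | ∃ i j, i ≠ j ∧ L * r < (x (v i) ⬝ᵥ x (v j)) ^ 2} +
      ENNReal.ofReal
        ((Fintype.card n + Fintype.card κ ^ 2 + Fintype.card κ) * E⁻¹ ^ m) := by
  set π := Measure.pi fun _ : κ => ν
  set k : ℝ := (Fintype.card κ : ℝ) with hk
  have hk0 : 0 ≤ k := Nat.cast_nonneg _
  set σ := E * (k + m * r) with hσ
  set R := E * (k * r + m * (L * r)) with hR
  have hσ0 : 0 ≤ σ := by positivity
  have hR0 : 0 ≤ R := by positivity
  set B1 : Set (κ → V) := {v | ∃ j, r < x (v j) ⬝ᵥ x (v j)} with hB1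
  set B2 : Set (κ → V) := {v | ∃ i j, i ≠ j ∧ L * r < (x (v i) ⬝ᵥ x (v j)) ^ 2} with hB2
  set C1 : Set (κ → V) := {v | ∀ j, x (v j) ⬝ᵥ x (v j) ≤ r} ∩
      {v | σ < ‖maskedRows x Finset.univ v‖ ^ 2} with hC1
  set C2 : κ → Set (κ → V) := fun j => crossGood x {j} r (L * r) ∩
      {v | R < ∑ i, offGram x v i j ^ 2} with hC2
  set C3 : Set (κ → V) := offGood x σ R ∩
      {v | E * (16 * (k * σ + m * R)) < ‖offGram x v‖ ^ 2} with hC3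
  have hsub : {v : κ → V | E * (16 * (k * σ + m * R)) < ‖offGram x v‖ ^ 2} ⊆
      (B1 ∪ B2) ∪ (C1 ∪ ((⋃ j, C2 j) ∪ C3)) := by
    intro v hv
    by_contra hcon
    simp only [Set.mem_union, Set.mem_iUnion, not_or, not_exists] at hcon
    obtain ⟨⟨n1, n2⟩, n3, n4, n5⟩ := hcon
    have a1 : ∀ j, x (v j) ⬝ᵥ x (v j) ≤ r := fun j => not_lt.1 fun h => n1 ⟨j, h⟩
    have a2 : ∀ i j, i ≠ j → (x (v i) ⬝ᵥ x (v j)) ^ 2 ≤ L * r := fun i j hij =>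
      not_lt.1 fun h => n2 ⟨i, j, hij, h⟩
    refine n5 ⟨⟨not_lt.1 fun h => n3 ⟨a1, h⟩, fun j => not_lt.1 fun h => n4 j ⟨?_, h⟩⟩, hv⟩
    exact mem_crossGood_singleton (a1 j) fun i hi => a2 j i hi.symm
  refine (measure_mono hsub).trans ((measure_union_le _ _).trans
    (add_le_add (measure_union_le _ _) ?_))
  have p1 : π C1 ≤ ENNReal.ofReal (Fintype.card n * E⁻¹ ^ m) :=
    measure_norm_maskedRows_gt_le hx hint hiso hr hE hm
  have p2 : π (⋃ j, C2 j) ≤ ENNReal.ofReal (k * (k * E⁻¹ ^ m)) := by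
    calc π (⋃ j, C2 j) ≤ ∑ j, π (C2 j) := measure_iUnion_fintype_le _ _
      _ ≤ ∑ _j : κ, ENNReal.ofReal (k * E⁻¹ ^ m) := Finset.sum_le_sum fun j _ =>
        measure_sum_offGram_sq_gt_le hx hint hiso hr (mul_nonneg hL hr) hE hm j
      _ = _ := by
        rw [Finset.sum_const, Finset.card_univ, nsmul_eq_mul,
          ENNReal.ofReal_mul (q := k * E⁻¹ ^ m) hk0, hk, ENNReal.ofReal_natCast]
  have p3 : π C3 ≤ ENNReal.ofReal (k * E⁻¹ ^ m) :=
    measure_norm_offGram_sq_gt_le hx hint hiso hσ0 hR0 hE hm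
  calc _ ≤ π C1 + (π (⋃ j, C2 j) + π C3) :=
        (measure_union_le _ _).trans (add_le_add le_rfl (measure_union_le _ _))
    _ ≤ ENNReal.ofReal (Fintype.card n * E⁻¹ ^ m) + (ENNReal.ofReal (k * (k * E⁻¹ ^ m)) +
        ENNReal.ofReal (k * E⁻¹ ^ m)) := add_le_add p1 (add_le_add p2 p3)
    _ = _ := by
        rw [← ENNReal.ofReal_add (by positivity) (by positivity),
          ← ENNReal.ofReal_add (by positivity) (by positivity)]
        congr 1
        ring

end IsotropicGram

/-! ### Isotropy and tails of Gaussian vectors and their tensor products -/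

section GaussianVectors

open Matrix

/-- The standard Gaussian measure on `Fin d → ℝ`. -/
noncomputable def gaussVec (d : ℕ) : Measure (Fin d → ℝ) := Measure.pi fun _ => gaussianReal 0 1

/-- The law of a pair of independent standard Gaussian vectors. -/
noncomputable def gaussPair (d : ℕ) : Measure ((Fin d → ℝ) × (Fin d → ℝ)) :=
  (gaussVec d).prod (gaussVec d)

instance (d : ℕ) : IsProbabilityMeasure (gaussVec d) := by unfold gaussVec; infer_instance

instance (d : ℕ) : IsProbabilityMeasure (gaussPair d) := by unfold gaussPair; infer_instance

/-- The tensor product of a pair of vectors. -/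
def pairTensor {d : ℕ} (v : (Fin d → ℝ) × (Fin d → ℝ)) : Fin d × Fin d → ℝ :=
  fun p => v.1 p.1 * v.2 p.2

variable {d : ℕ}

lemma pairTensor_dotProduct (v w : (Fin d → ℝ) × (Fin d → ℝ)) :
    pairTensor v ⬝ᵥ pairTensor w = (v.1 ⬝ᵥ w.1) * (v.2 ⬝ᵥ w.2) := by
  simp only [dotProduct, pairTensor, Fintype.sum_prod_type, Finset.sum_mul_sum]
  exact Finset.sum_congr rfl fun i _ => Finset.sum_congr rfl fun j _ => by ring

lemma measurable_pairTensor : Measurable (pairTensor (d := d)) :=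
  measurable_pi_lambda _ fun p =>
    ((measurable_pi_apply p.1).comp measurable_fst).mul
      ((measurable_pi_apply p.2).comp measurable_snd)

lemma memLp_coord_gaussVec (i : Fin d) : MemLp (fun a : Fin d → ℝ => a i) 2 (gaussVec d) :=
  (memLp_id_gaussianReal 2).comp_measurePreserving
    (measurePreserving_eval (fun _ : Fin d => gaussianReal 0 1) i)

lemma integrable_mul_coord_gaussVec (i j : Fin d) :
    Integrable (fun a : Fin d → ℝ => a i * a j) (gaussVec d) :=
  (memLp_coord_gaussVec i).integrable_mul (memLp_coord_gaussVec j)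

lemma integral_comp_coord_gaussVec {f : ℝ → ℝ} (hf : Measurable f) (i : Fin d) :
    ∫ a, f (a i) ∂(gaussVec d) = ∫ x, f x ∂(gaussianReal 0 1) := by
  have h := (measurePreserving_eval (fun _ : Fin d => gaussianReal 0 1) i).map_eq
  have h2 := integral_map (μ := gaussVec d) (φ := Function.eval i)
    (measurable_pi_apply i).aemeasurable (f := f) hf.aestronglyMeasurable
  rw [gaussVec, h] at h2
  exact h2.symm

lemma integral_mul_coord_gaussVec (i j : Fin d) :
    ∫ a, a i * a j ∂(gaussVec d) = if i = j then 1 else 0 := by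
  by_cases h : i = j
  · subst h
    rw [if_pos rfl, integral_comp_coord_gaussVec (f := fun x => x * x) (by fun_prop)]
    have hv := variance_id_gaussianReal (μ := 0) (v := 1)
    rw [variance_eq_integral measurable_id.aemeasurable] at hv
    simpa [sq] using hv
  · have hi : iIndepFun (fun (i : Fin d) (a : Fin d → ℝ) => a i) (gaussVec d) :=
      iIndepFun_pi (X := fun _ => id) fun _ => measurable_id.aemeasurable
    rw [if_neg h, (hi.indepFun h).integral_fun_mul_eq_mul_integral
      (memLp_coord_gaussVec i).1 (memLp_coord_gaussVec j).1,
      integral_comp_coord_gaussVec (f := fun x => x) measurable_id]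
    simp

lemma sq_dotProduct_pairTensor (u : Fin d × Fin d → ℝ) (v : (Fin d → ℝ) × (Fin d → ℝ)) :
    (u ⬝ᵥ pairTensor v) ^ 2 =
      ∑ p, ∑ q, (u p * u q) * ((v.1 p.1 * v.1 q.1) * (v.2 p.2 * v.2 q.2)) := by
  simp only [dotProduct, sq, Finset.sum_mul_sum, pairTensor]
  exact Finset.sum_congr rfl fun i _ => Finset.sum_congr rfl fun j _ => by ring

lemma integrable_pairTensor_term (u : Fin d × Fin d → ℝ) (p q : Fin d × Fin d) :
    Integrable (fun v : (Fin d → ℝ) × (Fin d → ℝ) =>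
      (u p * u q) * ((v.1 p.1 * v.1 q.1) * (v.2 p.2 * v.2 q.2))) (gaussPair d) :=
  ((integrable_mul_coord_gaussVec p.1 q.1).mul_prod
    (integrable_mul_coord_gaussVec p.2 q.2)).const_mul _

lemma integrable_sq_dotProduct_pairTensor (u : Fin d × Fin d → ℝ) :
    Integrable (fun v => (u ⬝ᵥ pairTensor v) ^ 2) (gaussPair d) := by
  simp only [sq_dotProduct_pairTensor]
  exact integrable_finsetSum _ fun p _ => integrable_finsetSum _ fun q _ =>
    integrable_pairTensor_term u p q

/-- The tensor product of two independent standard Gaussian vectors is isotropic. -/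
lemma integral_sq_dotProduct_pairTensor (u : Fin d × Fin d → ℝ) :
    ∫ v, (u ⬝ᵥ pairTensor v) ^ 2 ∂(gaussPair d) = u ⬝ᵥ u := by
  simp only [sq_dotProduct_pairTensor]
  rw [integral_finsetSum _ fun p _ => integrable_finsetSum _ fun q _ =>
    integrable_pairTensor_term u p q]
  refine Finset.sum_congr rfl fun p _ => ?_
  rw [integral_finsetSum _ fun q _ => integrable_pairTensor_term u p q, Finset.sum_eq_single p]
  · rw [integral_const_mul, gaussPair,
      integral_prod_mul (fun a : Fin d → ℝ => a p.1 * a p.1) (fun b : Fin d → ℝ => b p.2 * b p.2),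
      integral_mul_coord_gaussVec, integral_mul_coord_gaussVec]
    simp
  · intro q _ hq
    rw [integral_const_mul, gaussPair,
      integral_prod_mul (fun a : Fin d → ℝ => a p.1 * a q.1) (fun b : Fin d → ℝ => b p.2 * b q.2),
      integral_mul_coord_gaussVec, integral_mul_coord_gaussVec]
    by_cases h1 : p.1 = q.1
    · have h2 : p.2 ≠ q.2 := fun h2 => hq (Prod.ext h1 h2).symm
      simp [h2]
    · simp [h1]
  · simp

lemma integral_exp_mul_sq_gaussianReal {s : ℝ} (hs : s < 1 / 2) :
    ∫ x, Real.exp (s * x ^ 2) ∂(gaussianReal 0 1) = (√(1 - 2 * s))⁻¹ := by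
  rw [integral_gaussianReal_eq_integral_smul one_ne_zero]
  have e : ∀ x : ℝ, gaussianPDFReal 0 1 x • Real.exp (s * x ^ 2) =
      (√(2 * Real.pi))⁻¹ * Real.exp (-(1 / 2 - s) * x ^ 2) := by
    intro x
    simp only [gaussianPDFReal, smul_eq_mul, NNReal.coe_one, mul_one, sub_zero]
    rw [mul_assoc, ← Real.exp_add]
    congr 2
    ring
  simp only [e]
  have hs' : 0 < 1 / 2 - s := by linarith
  rw [integral_const_mul, integral_gaussian, ← Real.sqrt_inv, ← Real.sqrt_mul (by positivity),
    ← Real.sqrt_inv]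
  congr 1
  have : 1 - 2 * s ≠ 0 := by linarith
  have h1 : 1 / 2 - s = (1 - 2 * s) / 2 := by ring
  rw [h1]
  field_simp

lemma integral_exp_mul_dotProduct_self_gaussVec {s : ℝ} (hs : s < 1 / 2) :
    ∫ a, Real.exp (s * (a ⬝ᵥ a)) ∂(gaussVec d) = (√(1 - 2 * s))⁻¹ ^ d := by
  have e : ∀ a : Fin d → ℝ, Real.exp (s * (a ⬝ᵥ a)) = ∏ i, Real.exp (s * a i ^ 2) := by
    intro a
    rw [← Real.exp_sum, dotProduct, Finset.mul_sum]
    simp only [sq]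
  simp only [e]
  rw [gaussVec, integral_fintype_prod_eq_prod fun (_ : Fin d) (x : ℝ) => Real.exp (s * x ^ 2)]
  simp only [integral_exp_mul_sq_gaussianReal hs, Finset.prod_const, Finset.card_univ,
    Fintype.card_fin]

lemma integral_exp_mul_dotProduct_gaussVec (t : ℝ) (a : Fin d → ℝ) :
    ∫ b, Real.exp (t * (a ⬝ᵥ b)) ∂(gaussVec d) = Real.exp (t ^ 2 * (a ⬝ᵥ a) / 2) := by
  have e : ∀ b : Fin d → ℝ, Real.exp (t * (a ⬝ᵥ b)) = ∏ i, Real.exp ((t * a i) * b i) := by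
    intro b
    rw [← Real.exp_sum, dotProduct, Finset.mul_sum]
    simp only [mul_assoc]
  simp only [e]
  rw [gaussVec, integral_fintype_prod_eq_prod fun (i : Fin d) (x : ℝ) => Real.exp ((t * a i) * x)]
  have h : ∀ r : ℝ, ∫ x, Real.exp (r * x) ∂(gaussianReal 0 1) = Real.exp (r ^ 2 / 2) := by
    intro r
    have := congrFun (mgf_id_gaussianReal (μ := 0) (v := 1)) r
    simpa [mgf] using this
  simp only [h]
  rw [← Real.exp_sum, dotProduct, Finset.mul_sum, Finset.sum_div]
  congr 1
  exact Finset.sum_congr rfl fun i _ => by ring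

lemma gaussVec_dotProduct_self_ge_le :
    (gaussVec d).real {a | 8 * (d : ℝ) ≤ a ⬝ᵥ a} ≤ Real.exp (-(d / 2 : ℝ)) := by
  have hI := integral_exp_mul_dotProduct_self_gaussVec (d := d) (s := 1 / 4) (by norm_num)
  have hint : Integrable (fun a : Fin d → ℝ => Real.exp (1 / 4 * (a ⬝ᵥ a))) (gaussVec d) := by
    -- The integral of a non-integrable function is 0 by convention, so its positive value proves
    -- integrability.
    by_contra h
    rw [integral_undef h] at hI
    have : 0 < (√(1 - 2 * (1 / 4 : ℝ)))⁻¹ ^ d := by positivity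
    linarith
  refine (measure_ge_le_exp_mul_mgf (8 * (d : ℝ)) (by norm_num) hint).trans ?_
  rw [mgf, hI]
  have h1 : (√(1 - 2 * (1 / 4 : ℝ)))⁻¹ ≤ Real.exp 1 := by
    have h2 : (2 : ℝ)⁻¹ ≤ √(1 - 2 * (1 / 4 : ℝ)) := Real.le_sqrt_of_sq_le (by norm_num)
    have h3 := inv_anti₀ (by norm_num) h2
    have h4 := Real.add_one_le_exp (1 : ℝ)
    rw [inv_inv] at h3
    linarith
  calc _ ≤ Real.exp (-(1 / 4) * (8 * d)) * Real.exp 1 ^ d := by gcongr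
    _ = Real.exp (-(d : ℝ)) := by
      rw [← Real.exp_nat_mul, ← Real.exp_add]; congr 1; ring
    _ ≤ _ := Real.exp_le_exp.2 (by linarith [Nat.cast_nonneg (α := ℝ) d])

lemma gaussVec_dotProduct_self_le_le :
    (gaussVec d).real {a | a ⬝ᵥ a ≤ (d : ℝ) / 8} ≤ Real.exp (-(d / 2 : ℝ)) := by
  -- With `s = -4` the root is exactly 3 > e, so the bound `exp (d / 2) * 3⁻¹ ^ d` is at most `exp
  -- (-d / 2)`.
  have hI := integral_exp_mul_dotProduct_self_gaussVec (d := d) (s := -4) (by norm_num)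
  have hint : Integrable (fun a : Fin d → ℝ => Real.exp (-4 * (a ⬝ᵥ a))) (gaussVec d) := by
    by_contra h
    rw [integral_undef h] at hI
    have : 0 < (√(1 - 2 * (-4 : ℝ)))⁻¹ ^ d := by positivity
    linarith
  refine (measure_le_le_exp_mul_mgf ((d : ℝ) / 8) (by norm_num) hint).trans ?_
  rw [mgf, hI]
  have h9 : √(1 - 2 * (-4 : ℝ)) = 3 := by
    rw [show (1 - 2 * (-4 : ℝ)) = 3 ^ 2 by norm_num]; exact Real.sqrt_sq (by norm_num)
  have h1 : (3 : ℝ)⁻¹ ≤ Real.exp (-1) := by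
    rw [Real.exp_neg]
    exact inv_anti₀ (Real.exp_pos 1) (by linarith [Real.exp_one_lt_d9])
  rw [h9]
  calc _ ≤ Real.exp (-(-4) * (d / 8)) * Real.exp (-1) ^ d := by gcongr
    _ = _ := by rw [← Real.exp_nat_mul, ← Real.exp_add]; congr 1; ring

lemma gaussVec_sq_dotProduct_gt_le {a : Fin d → ℝ} {r q : ℝ} (hr : 0 < r) (ha : a ⬝ᵥ a ≤ r)
    (hq : 0 ≤ q) :
    (gaussVec d).real {b | (2 * q) * r < (a ⬝ᵥ b) ^ 2} ≤ 2 * Real.exp (-q) := by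
  set y : ℝ := √((2 * q) * r) with hy
  have hy2 : y ^ 2 = (2 * q) * r := Real.sq_sqrt (by positivity)
  have hy0 : 0 ≤ y := Real.sqrt_nonneg _
  have hI := fun t => integral_exp_mul_dotProduct_gaussVec t a
  have hint : ∀ t : ℝ, Integrable (fun b : Fin d → ℝ => Real.exp (t * (a ⬝ᵥ b))) (gaussVec d) := by
    intro t
    by_contra h
    have := hI t
    rw [integral_undef h] at this
    exact (Real.exp_pos _).ne this
  -- The optimal Chernoff parameter for a centred Gaussian of variance `r`.
  set t : ℝ := y / r with ht
  have ht0 : 0 ≤ t := by positivity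
  have hbound : Real.exp (-t * y) * Real.exp (t ^ 2 * (a ⬝ᵥ a) / 2) ≤ Real.exp (-q) := by
    rw [← Real.exp_add, Real.exp_le_exp]
    have h1 : t ^ 2 * (a ⬝ᵥ a) ≤ t ^ 2 * r := by gcongr
    have h2 : t ^ 2 * r = 2 * q := by
      rw [ht, div_pow, hy2]; field_simp
    have h3 : t * y = 2 * q := by
      rw [ht, div_mul_eq_mul_div, ← sq, hy2]; field_simp
    linarith
  have u1 := measure_ge_le_exp_mul_mgf y ht0 (hint t)
  have u2 := measure_le_le_exp_mul_mgf (-y) (neg_nonpos.2 ht0) (hint (-t))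
  rw [mgf, hI] at u1 u2
  rw [neg_sq, show -(-t) * -y = -t * y by ring] at u2
  have hsub : {b : Fin d → ℝ | (2 * q) * r < (a ⬝ᵥ b) ^ 2} ⊆
      {b | y ≤ a ⬝ᵥ b} ∪ {b | a ⬝ᵥ b ≤ -y} := by
    intro b hb
    rw [Set.mem_ofPred_eq, ← hy2] at hb
    have := sq_lt_sq.1 hb
    rw [abs_of_nonneg hy0] at this
    rcases lt_abs.1 this with h | h
    · exact Or.inl h.le
    · exact Or.inr (show a ⬝ᵥ b ≤ -y by linarith)
  have := (measureReal_mono hsub).trans (measureReal_union_le (μ := gaussVec d) _ _)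
  linarith

end GaussianVectors

/-! ### Bad events and the tail bound for Gaussian tensors -/

section GaussianGram

open Matrix

variable {d k : ℕ}

/-- The law of `k` independent pairs of independent standard Gaussian vectors. -/
noncomputable def gaussPairs (d k : ℕ) : Measure (Fin k → (Fin d → ℝ) × (Fin d → ℝ)) :=
  Measure.pi fun _ => gaussPair d

instance (d k : ℕ) : IsProbabilityMeasure (gaussPairs d k) := by
  unfold gaussPairs; infer_instance

/-- The event that some vector has squared norm outside of `(d / 8, 8 d)`. -/
def normBad (d k : ℕ) : Set (Fin k → (Fin d → ℝ) × (Fin d → ℝ)) :=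
  {v | ∃ j, ((v j).1 ⬝ᵥ (v j).1 ≤ (d : ℝ) / 8 ∨ 8 * (d : ℝ) ≤ (v j).1 ⬝ᵥ (v j).1) ∨
    ((v j).2 ⬝ᵥ (v j).2 ≤ (d : ℝ) / 8 ∨ 8 * (d : ℝ) ≤ (v j).2 ⬝ᵥ (v j).2)}

lemma measure_normBad_le :
    gaussPairs d k (normBad d k) ≤ ENNReal.ofReal (4 * k * Real.exp (-(d / 2 : ℝ))) := by
  set e := Real.exp (-(d / 2 : ℝ)) with he
  have he0 : 0 < e := Real.exp_pos _
  set s : Set (Fin d → ℝ) := {a | a ⬝ᵥ a ≤ (d : ℝ) / 8} ∪ {a | 8 * (d : ℝ) ≤ a ⬝ᵥ a} with hs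
  have h1 : gaussVec d s ≤ ENNReal.ofReal (2 * e) := by
    rw [← ofReal_measureReal]
    refine ENNReal.ofReal_le_ofReal ((measureReal_union_le _ _).trans ?_)
    linarith [gaussVec_dotProduct_self_ge_le (d := d), gaussVec_dotProduct_self_le_le (d := d)]
  have h2 : gaussPair d (Prod.fst ⁻¹' s ∪ Prod.snd ⁻¹' s) ≤ ENNReal.ofReal (4 * e) := by
    refine (measure_union_le _ _).trans ?_
    have f1 : gaussPair d (Prod.fst ⁻¹' s) ≤ gaussVec d s := by
      have := Measure.le_map_apply (μ := gaussPair d) measurable_fst.aemeasurable s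
      rwa [gaussPair, measurePreserving_fst.map_eq] at this
    have f2 : gaussPair d (Prod.snd ⁻¹' s) ≤ gaussVec d s := by
      have := Measure.le_map_apply (μ := gaussPair d) measurable_snd.aemeasurable s
      rwa [gaussPair, measurePreserving_snd.map_eq] at this
    calc _ ≤ ENNReal.ofReal (2 * e) + ENNReal.ofReal (2 * e) :=
          add_le_add (f1.trans h1) (f2.trans h1)
      _ = _ := by rw [← ENNReal.ofReal_add (by positivity) (by positivity)]; congr 1; ring
  have h3 : normBad d k = ⋃ j, Function.eval j ⁻¹' (Prod.fst ⁻¹' s ∪ Prod.snd ⁻¹' s) := by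
    ext v
    simp only [Set.mem_iUnion]
    rfl
  rw [h3]
  calc _ ≤ ∑ j : Fin k, gaussPairs d k (Function.eval j ⁻¹' (Prod.fst ⁻¹' s ∪ Prod.snd ⁻¹' s)) :=
        measure_iUnion_fintype_le _ _
    _ ≤ ∑ _j : Fin k, ENNReal.ofReal (4 * e) := Finset.sum_le_sum fun j _ => by
        have := Measure.le_map_apply (μ := gaussPairs d k) (measurable_pi_apply j).aemeasurable
          (Prod.fst ⁻¹' s ∪ Prod.snd ⁻¹' s)
        rw [gaussPairs, (measurePreserving_eval (fun _ : Fin k => gaussPair d) j).map_eq] at this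
        exact this.trans h2
    _ = _ := by
        rw [Finset.sum_const, Finset.card_univ, Fintype.card_fin, nsmul_eq_mul,
          ← ENNReal.ofReal_natCast, ← ENNReal.ofReal_mul (Nat.cast_nonneg _)]
        congr 1
        ring

lemma map_pair_gaussPairs {f : (Fin d → ℝ) × (Fin d → ℝ) → Fin d → ℝ}
    (hf : MeasurePreserving f (gaussPair d) (gaussVec d)) {i j : Fin k} (hij : i ≠ j) :
    Measure.map (fun v => (f (v i), f (v j))) (gaussPairs d k) =
      (gaussVec d).prod (gaussVec d) := by
  have hmp : ∀ l : Fin k, MeasurePreserving (fun v : Fin k → _ => f (v l)) (gaussPairs d k)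
      (gaussVec d) := fun l => hf.comp (measurePreserving_eval (fun _ : Fin k => gaussPair d) l)
  have hi : iIndepFun (fun (l : Fin k) (v : Fin k → (Fin d → ℝ) × (Fin d → ℝ)) => f (v l))
      (gaussPairs d k) := iIndepFun_pi (X := fun _ => f) fun _ => hf.measurable.aemeasurable
  rw [(indepFun_iff_map_prod_eq_prod_map_map (hmp i).measurable.aemeasurable
    (hmp j).measurable.aemeasurable).1 (hi.indepFun hij), (hmp i).map_eq, (hmp j).map_eq]

/-- Given the first vector, the inner product with the independent second one is Gaussian with
variance at most `r`. -/
lemma measure_sq_dotProduct_gt_le {f : (Fin d → ℝ) × (Fin d → ℝ) → Fin d → ℝ}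
    (hf : MeasurePreserving f (gaussPair d) (gaussVec d)) {i j : Fin k} (hij : i ≠ j) {r q : ℝ}
    (hr : 0 < r) (hq : 0 ≤ q) :
    gaussPairs d k {v | f (v i) ⬝ᵥ f (v i) ≤ r ∧ (2 * q) * r < (f (v i) ⬝ᵥ f (v j)) ^ 2} ≤
      ENNReal.ofReal (2 * Real.exp (-q)) := by
  set s : Set ((Fin d → ℝ) × (Fin d → ℝ)) :=
    {z | z.1 ⬝ᵥ z.1 ≤ r ∧ (2 * q) * r < (z.1 ⬝ᵥ z.2) ^ 2} with hs
  have hsm : MeasurableSet s :=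
    (measurableSet_le (measurable_dotProduct measurable_fst measurable_fst)
      measurable_const).inter (measurableSet_lt measurable_const
        ((measurable_dotProduct measurable_fst measurable_snd).pow_const 2))
  have hm : Measurable fun v : Fin k → (Fin d → ℝ) × (Fin d → ℝ) => (f (v i), f (v j)) :=
    (hf.measurable.comp (measurable_pi_apply i)).prodMk
      (hf.measurable.comp (measurable_pi_apply j))
  have h := Measure.le_map_apply (μ := gaussPairs d k) hm.aemeasurable s
  rw [map_pair_gaussPairs hf hij, Measure.prod_apply hsm] at h
  refine h.trans ?_
  refine (lintegral_mono (g := fun _ => ENNReal.ofReal (2 * Real.exp (-q))) fun a => ?_).trans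
    (by simp)
  by_cases ha : a ⬝ᵥ a ≤ r
  · refine (measure_mono (t := {b | (2 * q) * r < (a ⬝ᵥ b) ^ 2}) fun b hb => hb.2).trans ?_
    rw [← ofReal_measureReal]
    exact ENNReal.ofReal_le_ofReal (gaussVec_sq_dotProduct_gt_le hr ha hq)
  · have : Prod.mk a ⁻¹' s = ∅ := by
      ext b
      simp [hs, ha]
    simp [this]

/-- The inner products of distinct tensors are small outside of a small event. -/
lemma measure_sq_pairTensor_gt_le (hd : 0 < d) {q : ℝ} (hq : 0 ≤ q) :
    gaussPairs d k {v | ∃ i j, i ≠ j ∧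
      (2 * q) ^ 2 * (8 * (d : ℝ)) ^ 2 < (pairTensor (v i) ⬝ᵥ pairTensor (v j)) ^ 2} ≤
      gaussPairs d k (normBad d k) + ENNReal.ofReal (4 * k ^ 2 * Real.exp (-q)) := by
  have hr : (0 : ℝ) < 8 * d := by positivity
  set e := Real.exp (-q) with he
  have he0 : 0 < e := Real.exp_pos _
  set G : ((Fin d → ℝ) × (Fin d → ℝ) → Fin d → ℝ) → Fin k → Fin k →
      Set (Fin k → (Fin d → ℝ) × (Fin d → ℝ)) := fun f i j =>
    {v | i ≠ j ∧ f (v i) ⬝ᵥ f (v i) ≤ 8 * d ∧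
      (2 * q) * (8 * d) < (f (v i) ⬝ᵥ f (v j)) ^ 2} with hG
  have hGle : ∀ f, MeasurePreserving f (gaussPair d) (gaussVec d) → ∀ i j,
      gaussPairs d k (G f i j) ≤ ENNReal.ofReal (2 * e) := by
    intro f hf i j
    by_cases hij : i = j
    · simp [hG, hij]
    · exact (measure_mono fun v hv => hv.2).trans (measure_sq_dotProduct_gt_le hf hij hr hq)
  have hsub : {v : Fin k → (Fin d → ℝ) × (Fin d → ℝ) | ∃ i j, i ≠ j ∧
      (2 * q) ^ 2 * (8 * (d : ℝ)) ^ 2 < (pairTensor (v i) ⬝ᵥ pairTensor (v j)) ^ 2} ⊆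
      normBad d k ∪ ⋃ i, ⋃ j, (G Prod.fst i j ∪ G Prod.snd i j) := by
    rintro v ⟨i, j, hij, h⟩
    by_contra hcon
    simp only [Set.mem_union, Set.mem_iUnion, not_or, not_exists] at hcon
    obtain ⟨n1, n2⟩ := hcon
    have b1 : (v i).1 ⬝ᵥ (v i).1 ≤ 8 * d := by
      by_contra hb; exact n1 ⟨i, Or.inl (Or.inr (not_le.1 hb).le)⟩
    have b2 : (v i).2 ⬝ᵥ (v i).2 ≤ 8 * d := by
      by_contra hb; exact n1 ⟨i, Or.inr (Or.inr (not_le.1 hb).le)⟩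
    have c1 : ((v i).1 ⬝ᵥ (v j).1) ^ 2 ≤ (2 * q) * (8 * d) :=
      not_lt.1 fun hc => (n2 i j).1 ⟨hij, b1, hc⟩
    have c2 : ((v i).2 ⬝ᵥ (v j).2) ^ 2 ≤ (2 * q) * (8 * d) :=
      not_lt.1 fun hc => (n2 i j).2 ⟨hij, b2, hc⟩
    rw [pairTensor_dotProduct, mul_pow] at h
    have := mul_le_mul c1 c2 (sq_nonneg _) (by positivity)
    nlinarith
  refine (measure_mono hsub).trans ((measure_union_le _ _).trans (add_le_add le_rfl ?_))
  calc _ ≤ ∑ i : Fin k, ∑ j : Fin k, gaussPairs d k (G Prod.fst i j ∪ G Prod.snd i j) :=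
        (measure_iUnion_fintype_le _ _).trans
          (Finset.sum_le_sum fun i _ => measure_iUnion_fintype_le _ _)
    _ ≤ ∑ _i : Fin k, ∑ _j : Fin k, ENNReal.ofReal (4 * e) :=
        Finset.sum_le_sum fun i _ => Finset.sum_le_sum fun j _ => by
          refine (measure_union_le _ _).trans ((add_le_add
            (hGle _ measurePreserving_fst i j) (hGle _ measurePreserving_snd i j)).trans ?_)
          rw [← ENNReal.ofReal_add (by positivity) (by positivity)]
          exact ENNReal.ofReal_le_ofReal (by linarith)
    _ = _ := by
        simp only [Finset.sum_const, Finset.card_univ, Fintype.card_fin, nsmul_eq_mul,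
          ← ENNReal.ofReal_natCast]
        rw [← ENNReal.ofReal_mul (Nat.cast_nonneg _), ← ENNReal.ofReal_mul (Nat.cast_nonneg _)]
        congr 1
        ring

/-- Tail bound for the off-diagonal part of the Gram matrix of Gaussian tensors. -/
theorem measure_norm_offGram_pairTensor_gt_le (hd : 0 < d) {q E : ℝ} (hq : 0 ≤ q) (hE : 0 < E)
    {m : ℕ} (hm : m ≠ 0) :
    gaussPairs d k ({v | E * (16 * (k * (E * (k + m * (8 * (d : ℝ)) ^ 2)) +
        m * (E * (k * (8 * (d : ℝ)) ^ 2 + m * ((2 * q) ^ 2 * (8 * (d : ℝ)) ^ 2))))) <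
          ‖offGram pairTensor v‖ ^ 2} ∪ normBad d k) ≤
      ENNReal.ofReal (12 * k * Real.exp (-(d / 2 : ℝ)) + 4 * k ^ 2 * Real.exp (-q) +
        ((d : ℝ) ^ 2 + (k : ℝ) ^ 2 + k) * E⁻¹ ^ m) := by
  have key := measure_norm_offGram_gt_le (κ := Fin k) (ν := gaussPair d)
    (measurable_pairTensor (d := d)) integrable_sq_dotProduct_pairTensor
    (fun u => (integral_sq_dotProduct_pairTensor u).le) (r := (8 * (d : ℝ)) ^ 2)
    (L := (2 * q) ^ 2) (by positivity) (by positivity) hE hm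
  have hB1 : {v : Fin k → (Fin d → ℝ) × (Fin d → ℝ) | ∃ j,
      (8 * (d : ℝ)) ^ 2 < pairTensor (v j) ⬝ᵥ pairTensor (v j)} ⊆ normBad d k := by
    rintro v ⟨j, hj⟩
    by_contra hcon
    have b1 : (v j).1 ⬝ᵥ (v j).1 ≤ 8 * d := by
      by_contra hb; exact hcon ⟨j, Or.inl (Or.inr (not_le.1 hb).le)⟩
    have b2 : (v j).2 ⬝ᵥ (v j).2 ≤ 8 * d := by
      by_contra hb; exact hcon ⟨j, Or.inr (Or.inr (not_le.1 hb).le)⟩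
    rw [pairTensor_dotProduct] at hj
    have := mul_le_mul b1 b2 (dotProduct_self_star_nonneg (v j).2) (by positivity)
    nlinarith
  have hN := measure_normBad_le (d := d) (k := k)
  have hB2 := measure_sq_pairTensor_gt_le (k := k) hd hq
  simp only [Fintype.card_fin, Fintype.card_prod] at key
  set N := ENNReal.ofReal (4 * k * Real.exp (-(d / 2 : ℝ))) with hNdef
  refine (measure_union_le _ _).trans ?_
  calc _ ≤ (N + (N + ENNReal.ofReal (4 * k ^ 2 * Real.exp (-q))) +
        ENNReal.ofReal (((d : ℝ) ^ 2 + (k : ℝ) ^ 2 + k) * E⁻¹ ^ m)) + N := by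
        refine add_le_add (key.trans (add_le_add (add_le_add ((measure_mono hB1).trans hN)
          (hB2.trans (add_le_add hN le_rfl))) (le_of_eq ?_))) hN
        push_cast
        rw [sq (d : ℝ)]
    _ = _ := by
        rw [hNdef, ← ENNReal.ofReal_add (by positivity) (by positivity),
          ← ENNReal.ofReal_add (by positivity) (by positivity),
          ← ENNReal.ofReal_add (by positivity) (by positivity),
          ← ENNReal.ofReal_add (by positivity) (by positivity)]
        congr 1
        ring

end GaussianGram

/-! ### Choice of parameters -/

section Asymptotics

lemma eventually_exp_neg_half_le (c : ℝ) :
    ∀ᶠ d : ℕ in Filter.atTop,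
      12 * (d : ℝ) ^ 2 * Real.exp (-(d / 2 : ℝ)) ≤ 1 / 2 * (d : ℝ) ^ (-c) := by
  have h := (tendsto_rpow_mul_exp_neg_mul_atTop_nhds_zero (c + 2) (1 / 2) (by norm_num)).comp
    (tendsto_natCast_atTop_atTop (R := ℝ))
  filter_upwards [h.eventually (gt_mem_nhds (show (0 : ℝ) < 1 / 24 by norm_num)),
    Filter.eventually_gt_atTop 0] with d hd hd0
  have hd0' : (0 : ℝ) < d := by exact_mod_cast hd0
  have e : (d : ℝ) ^ 2 = (d : ℝ) ^ (c + 2) * (d : ℝ) ^ (-c) := by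
    rw [← Real.rpow_add hd0', ← Real.rpow_natCast]
    congr 1
    push_cast
    ring
  have h1 : (d : ℝ) ^ (c + 2) * Real.exp (-(d / 2 : ℝ)) ≤ 1 / 24 := by
    refine le_of_eq_of_le ?_ hd.le
    simp only [Function.comp_apply]
    congr 2
    ring
  have h2 : 0 < (d : ℝ) ^ (-c) := Real.rpow_pos_of_pos hd0' _
  rw [e]
  nlinarith

/-- With `l` and `D` in the roles of log d and d, every term is at most a multiple of `D ^ 2 * (k *
l)`. The bound `k ≤ D ^ 2` handles `k * k`; the bound `l ^ 3 < k` is needed only for the term in `m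
^ 2 * l ^ 2`. -/
lemma gram_threshold_le {E θ k l m D : ℝ} (hl : 1 ≤ l) (hm0 : 0 ≤ m) (hm : m ≤ 2 * l)
    (hk1 : l ^ 3 < k) (hk2 : k ≤ D ^ 2) :
    E * (16 * (k * (E * (k + m * (8 * D) ^ 2)) +
        m * (E * (k * (8 * D) ^ 2 + m * ((2 * (θ * l)) ^ 2 * (8 * D) ^ 2))))) ≤
      16 * E ^ 2 * (257 + 1024 * θ ^ 2) * (D ^ 2 * (k * l)) := by
  have hk0 : 0 ≤ k := le_trans (by positivity) hk1.le
  have h1 : k * k ≤ D ^ 2 * (k * l) := by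
    have : k * k ≤ k * D ^ 2 := mul_le_mul_of_nonneg_left hk2 hk0
    have h2 : k * D ^ 2 * 1 ≤ k * D ^ 2 * l := mul_le_mul_of_nonneg_left hl (by positivity)
    linarith
  have h2 : m * (k * D ^ 2) ≤ 2 * (D ^ 2 * (k * l)) := by
    have := mul_le_mul_of_nonneg_right hm (show 0 ≤ k * D ^ 2 by positivity)
    linarith
  have h3 : m ^ 2 * (l ^ 2 * D ^ 2) ≤ 4 * (D ^ 2 * (k * l)) := by
    have a1 : m ^ 2 ≤ (2 * l) ^ 2 := by gcongr
    have a2 := mul_le_mul_of_nonneg_right a1 (show 0 ≤ l ^ 2 * D ^ 2 by positivity)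
    have a3 := mul_le_mul_of_nonneg_right hk1.le (show 0 ≤ 4 * l * D ^ 2 by positivity)
    linarith
  have h4 := mul_le_mul_of_nonneg_left h3 (show 0 ≤ 256 * θ ^ 2 by positivity)
  have h5 : k * (k + m * (8 * D) ^ 2) +
        m * (k * (8 * D) ^ 2 + m * ((2 * (θ * l)) ^ 2 * (8 * D) ^ 2)) ≤
      (257 + 1024 * θ ^ 2) * (D ^ 2 * (k * l)) := by
    linarith
  have h6 := mul_le_mul_of_nonneg_left h5 (show 0 ≤ 16 * E ^ 2 by positivity)
  linarith

/-- The off-diagonal part of the Gram matrix of Gaussian tensors has norm `O(d √(k log d))`, and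
all the vectors have squared norm of order `d`, with high probability. -/
theorem exists_measure_offGram_bad_le {c : ℝ} (hc : 0 < c) :
    ∃ C : ℝ, 0 < C ∧ ∃ d₀ : ℕ, 0 < d₀ ∧ ∀ d : ℕ, d₀ ≤ d → ∀ k : ℕ,
      Real.log d ^ 3 < k → (k : ℝ) ≤ (d : ℝ) ^ 2 →
      gaussPairs d k ({v | C * (d * √(k * Real.log d)) < ‖offGram pairTensor v‖} ∪ normBad d k) ≤
        ENNReal.ofReal ((d : ℝ) ^ (-c)) := by
  -- The union bounds cost up to d⁴, since k ≤ d². The exponent `c + 6` leaves a spare factor d⁻² ≤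
  -- 1/16, which absorbs the constant 4 + 3; the other half of the probability goes to the norm
  -- event.
  set θ : ℝ := c + 6 with hθ
  set E : ℝ := Real.exp θ with hE
  have hE0 : 0 < E := Real.exp_pos _
  set K : ℝ := 16 * E ^ 2 * (257 + 1024 * θ ^ 2) with hK
  have hK0 : 0 < K := by positivity
  obtain ⟨d₁, hd₁⟩ := Filter.eventually_atTop.1 (eventually_exp_neg_half_le c)
  refine ⟨√K, Real.sqrt_pos.2 hK0, max d₁ 4, by simp, fun d hd k hk1 hk2 => ?_⟩
  have hd4 : (4 : ℝ) ≤ d := by exact_mod_cast (le_max_right _ _).trans hd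
  have hd0 : (0 : ℝ) < d := by linarith
  have hdn : 0 < d := by exact_mod_cast hd0
  set l := Real.log d with hl
  have hl1 : 1 ≤ l := by
    rw [hl, Real.le_log_iff_exp_le hd0]
    linarith [Real.exp_one_lt_d9]
  -- A moment of order log d suffices: `E⁻¹ ^ m ≤ exp (-θ l)`, which is d to the power -θ.
  set m := ⌈l⌉₊ with hm
  have hm1 : l ≤ m := Nat.le_ceil l
  have hm2 : (m : ℝ) ≤ 2 * l := by
    have := Nat.ceil_lt_add_one (show 0 ≤ l by linarith)
    linarith
  have hm0 : m ≠ 0 := by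
    intro h
    rw [h] at hm1
    norm_num at hm1
    linarith
  have hθ0 : 0 < θ := by positivity
  have key := measure_norm_offGram_pairTensor_gt_le (k := k) hdn (q := θ * l) (by positivity) hE0
    hm0
  refine le_trans (measure_mono (Set.union_subset_union_left _ fun v hv => ?_))
    (key.trans (ENNReal.ofReal_le_ofReal ?_))
  · rw [Set.mem_ofPred_eq] at hv ⊢
    refine lt_of_le_of_lt (gram_threshold_le hl1 (Nat.cast_nonneg m) hm2 hk1 hk2) ?_
    have h0 : 0 ≤ √K * (d * √(k * l)) := by positivity
    have h1 := pow_lt_pow_left₀ hv h0 two_ne_zero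
    rw [mul_pow, mul_pow, Real.sq_sqrt hK0.le, Real.sq_sqrt (by positivity)] at h1
    exact h1
  · have hp : 0 < (d : ℝ) ^ (-c) := Real.rpow_pos_of_pos hd0 _
    have e1 : Real.exp (-(θ * l)) = (d : ℝ) ^ (-θ) := by
      rw [Real.rpow_def_of_pos hd0]; congr 1; ring
    have e2 : E⁻¹ ^ m ≤ (d : ℝ) ^ (-θ) := by
      rw [← e1, hE, ← Real.exp_neg, ← Real.exp_nat_mul, Real.exp_le_exp]
      nlinarith
    have e3 : (d : ℝ) ^ 4 * (d : ℝ) ^ (-θ) = ((d : ℝ) ^ 2)⁻¹ * (d : ℝ) ^ (-c) := by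
      rw [← Real.rpow_natCast, ← Real.rpow_natCast, ← Real.rpow_neg hd0.le, ← Real.rpow_add hd0,
        ← Real.rpow_add hd0]
      congr 1
      push_cast
      rw [hθ]
      ring
    have hkk : (k : ℝ) ^ 2 ≤ (d : ℝ) ^ 4 := by
      calc (k : ℝ) ^ 2 ≤ ((d : ℝ) ^ 2) ^ 2 := by gcongr
        _ = _ := by ring
    have hd24 : (d : ℝ) ^ 2 ≤ (d : ℝ) ^ 4 := pow_le_pow_right₀ (by linarith) (by norm_num)
    have p0 : 0 < (d : ℝ) ^ (-θ) := Real.rpow_pos_of_pos hd0 _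
    have t1 : 12 * (k : ℝ) * Real.exp (-(d / 2 : ℝ)) ≤ 1 / 2 * (d : ℝ) ^ (-c) := by
      refine le_trans ?_ (hd₁ d ((le_max_left _ _).trans hd))
      gcongr
    have t2 : 4 * (k : ℝ) ^ 2 * Real.exp (-(θ * l)) ≤ 4 * ((d : ℝ) ^ 4 * (d : ℝ) ^ (-θ)) := by
      rw [e1, mul_assoc]
      gcongr
    have t3 : ((d : ℝ) ^ 2 + (k : ℝ) ^ 2 + k) * E⁻¹ ^ m ≤
        3 * ((d : ℝ) ^ 4 * (d : ℝ) ^ (-θ)) := by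
      calc _ ≤ (3 * (d : ℝ) ^ 4) * (d : ℝ) ^ (-θ) := by
            gcongr
            linarith
        _ = _ := by ring
    have h16 : ((d : ℝ) ^ 2)⁻¹ ≤ 1 / 16 := by
      rw [one_div]
      exact inv_anti₀ (by norm_num) (by nlinarith)
    rw [e3] at t2 t3
    have := mul_le_mul_of_nonneg_right h16 hp.le
    linarith

end Asymptotics

/-! ### Transfer to the random matrices and to normalized columns -/

section Transport

open Matrix

variable {Ω : Type*} [MeasurableSpace Ω] {P : Measure Ω} [IsProbabilityMeasure P] {d k : ℕ}

/-- The pairs of corresponding columns of two matrices. -/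
def colPairs (A B : Matrix (Fin d) (Fin k) ℝ) : Fin k → (Fin d → ℝ) × (Fin d → ℝ) :=
  fun j => (fun i => A i j, fun i => B i j)

lemma IsGaussianMatrix.map_transpose {A : Ω → Matrix (Fin d) (Fin k) ℝ}
    (hA : IsGaussianMatrix A P) :
    Measure.map (fun ω (ji : Fin k × Fin d) => A ω ji.2 ji.1) P =
      Measure.pi fun _ => gaussianReal 0 1 := by
  have h := hA.indep.precomp (g := fun ji : Fin k × Fin d => (ji.2, ji.1))
    (fun a b hab => by simpa [Prod.ext_iff, and_comm] using hab)
  refine ((iIndepFun_iff_map_fun_eq_pi_map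
    fun ji : Fin k × Fin d => (hA.hasLaw ji.2 ji.1).aemeasurable).1 h).trans ?_
  congr 1
  funext ji
  exact (hA.hasLaw ji.2 ji.1).map_eq

lemma measurePreserving_curry_gauss (d k : ℕ) :
    MeasurePreserving (MeasurableEquiv.curry (Fin k) (Fin d) ℝ)
      (Measure.pi fun _ => gaussianReal 0 1) (Measure.pi fun _ => gaussVec d) := by
  refine ⟨MeasurableEquiv.measurable _, ?_⟩
  have h := Measure.infinitePi_map_curry (fun (_ : Fin k) (_ : Fin d) => gaussianReal 0 1)
  simp only [Measure.infinitePi_eq_pi] at h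
  exact h

/-- The entries of each matrix are regrouped by columns, and then the two families of columns are
zipped into pairs; both regroupings preserve the product measures. -/
lemma map_colPairs {A B : Ω → Matrix (Fin d) (Fin k) ℝ} (hA : IsGaussianMatrix A P)
    (hB : IsGaussianMatrix B P)
    (hAB : IndepFun (fun ω (ij : Fin d × Fin k) => A ω ij.1 ij.2)
      (fun ω (ij : Fin d × Fin k) => B ω ij.1 ij.2) P) :
    AEMeasurable (fun ω => colPairs (A ω) (B ω)) P ∧
      Measure.map (fun ω => colPairs (A ω) (B ω)) P = gaussPairs d k := by
  set a : Ω → Fin k × Fin d → ℝ := fun ω ji => A ω ji.2 ji.1 with ha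
  set b : Ω → Fin k × Fin d → ℝ := fun ω ji => B ω ji.2 ji.1 with hb
  have ham : AEMeasurable a P := aemeasurable_pi_lambda _ fun ji => (hA.hasLaw _ _).aemeasurable
  have hbm : AEMeasurable b P := aemeasurable_pi_lambda _ fun ji => (hB.hasLaw _ _).aemeasurable
  have hswap : Measurable fun (z : Fin d × Fin k → ℝ) (ji : Fin k × Fin d) => z (ji.2, ji.1) :=
    measurable_pi_lambda _ fun ji => measurable_pi_apply _
  have hind : IndepFun a b P := hAB.comp hswap hswap
  have hab := (indepFun_iff_map_prod_eq_prod_map_map ham hbm).1 hind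
  rw [hA.map_transpose, hB.map_transpose] at hab
  have hc := (measurePreserving_curry_gauss d k).prod (measurePreserving_curry_gauss d k)
  have hp := (measurePreserving_arrowProdEquivProdArrow (Fin d → ℝ) (Fin d → ℝ) (Fin k)
    (fun _ => gaussVec d) (fun _ => gaussVec d)).symm
  have hΨ := hp.comp hc
  have hm : AEMeasurable (fun ω => (a ω, b ω)) P := ham.prodMk hbm
  refine ⟨?_, ?_⟩
  · exact hΨ.measurable.comp_aemeasurable hm
  · have := AEMeasurable.map_map_of_aemeasurable hΨ.measurable.aemeasurable hm
    rw [hab, hΨ.map_eq] at this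
    exact this.symm

lemma khatriRaoGram_apply (A B : Matrix (Fin d) (Fin k) ℝ) (i j : Fin k) :
    khatriRaoGram A B i j = (∑ l, A l i * A l j) * ∑ l, B l i * B l j := by
  simp only [khatriRaoGram, khatriRao, Matrix.mul_apply, transpose_apply, of_apply,
    Fintype.sum_prod_type, Finset.sum_mul_sum]
  exact Finset.sum_congr rfl fun _ _ => Finset.sum_congr rfl fun _ _ => by ring

lemma khatriRaoGram_eq_hadamard (A B : Matrix (Fin d) (Fin k) ℝ) :
    khatriRaoGram A B = Matrix.hadamard (A.transpose * A) (B.transpose * B) := by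
  ext i j
  rw [khatriRaoGram_apply, hadamard_apply, Matrix.mul_apply, Matrix.mul_apply]
  rfl

lemma khatriRaoGram_sub_diagonal (A B : Matrix (Fin d) (Fin k) ℝ) :
    khatriRaoGram A B - diagonal (khatriRaoGram A B).diag = offGram pairTensor (colPairs A B) := by
  ext i j
  rw [Matrix.sub_apply, offGram, of_apply, pairTensor_dotProduct]
  by_cases h : i = j
  · subst h; simp
  · rw [diagonal_apply_ne _ h, if_neg h, sub_zero, khatriRaoGram_apply]
    rfl

/-- Unit columns make the diagonal exactly 1, so no concentration of the norms is needed, only a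
lower bound of order d on their squares. -/
lemma khatriRaoGram_normalizeCols_sub_one {A B : Matrix (Fin d) (Fin k) ℝ}
    (hA : ∀ j, 0 < ∑ l, A l j ^ 2) (hB : ∀ j, 0 < ∑ l, B l j ^ 2) :
    khatriRaoGram (normalizeCols A) (normalizeCols B) - 1 =
      diagonal (fun j => (√(∑ l, A l j ^ 2) * √(∑ l, B l j ^ 2))⁻¹) *
        offGram pairTensor (colPairs A B) *
          diagonal (fun j => (√(∑ l, A l j ^ 2) * √(∑ l, B l j ^ 2))⁻¹) := by
  have e : ∀ (M : Matrix (Fin d) (Fin k) ℝ) (i j : Fin k),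
      ∑ l, normalizeCols M l i * normalizeCols M l j =
        (√(∑ l, M l i ^ 2))⁻¹ * (∑ l, M l i * M l j) * (√(∑ l, M l j ^ 2))⁻¹ := by
    intro M i j
    simp only [normalizeCols, of_apply, Finset.mul_sum, Finset.sum_mul]
    exact Finset.sum_congr rfl fun l _ => by ring
  have e1 : ∀ (M : Matrix (Fin d) (Fin k) ℝ) (j : Fin k), 0 < ∑ l, M l j ^ 2 →
      ∑ l, normalizeCols M l j * normalizeCols M l j = 1 := by
    intro M j hM
    rw [e]
    have h1 : ∑ l, M l j * M l j = √(∑ l, M l j ^ 2) * √(∑ l, M l j ^ 2) := by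
      rw [Real.mul_self_sqrt hM.le]
      simp only [sq]
    have h2 : √(∑ l, M l j ^ 2) ≠ 0 := (Real.sqrt_pos.2 hM).ne'
    rw [h1]
    field_simp
  ext i j
  rw [Matrix.sub_apply, mul_diagonal, diagonal_mul, offGram, of_apply, pairTensor_dotProduct,
    khatriRaoGram_apply]
  by_cases h : i = j
  · subst h
    simp [e1 A i (hA i), e1 B i (hB i)]
  · rw [one_apply_ne h, if_neg h, sub_zero, e, e, mul_inv, mul_inv]
    change _ = _ * ((∑ l, A l i * A l j) * ∑ l, B l i * B l j) * _
    ring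

lemma norm_khatriRaoGram_normalizeCols_sub_one_le {A B : Matrix (Fin d) (Fin k) ℝ} (hd : 0 < d)
    (h : colPairs A B ∉ normBad d k) :
    ‖khatriRaoGram (normalizeCols A) (normalizeCols B) - 1‖ ≤
      64 / (d : ℝ) ^ 2 * ‖offGram pairTensor (colPairs A B)‖ := by
  have hd' : (0 : ℝ) < d := by exact_mod_cast hd
  have hA : ∀ j, (d : ℝ) / 8 ≤ ∑ l, A l j ^ 2 := by
    intro j
    by_contra hcon
    refine h ⟨j, Or.inl (Or.inl (le_of_eq_of_le ?_ (not_le.1 hcon).le))⟩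
    simp [colPairs, dotProduct, sq]
  have hB : ∀ j, (d : ℝ) / 8 ≤ ∑ l, B l j ^ 2 := by
    intro j
    by_contra hcon
    refine h ⟨j, Or.inr (Or.inl (le_of_eq_of_le ?_ (not_le.1 hcon).le))⟩
    simp [colPairs, dotProduct, sq]
  rw [khatriRaoGram_normalizeCols_sub_one (fun j => lt_of_lt_of_le (by positivity) (hA j))
    (fun j => lt_of_lt_of_le (by positivity) (hB j))]
  set D : Matrix (Fin k) (Fin k) ℝ :=
    diagonal (fun j => (√(∑ l, A l j ^ 2) * √(∑ l, B l j ^ 2))⁻¹) with hD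
  have hDn : ‖D‖ ≤ 8 / d := by
    rw [hD, l2_opNorm_diagonal]
    refine (pi_norm_le_iff_of_nonneg (by positivity)).2 fun j => ?_
    rw [Real.norm_of_nonneg (by positivity), ← inv_div]
    refine inv_anti₀ (by positivity) ?_
    rw [← Real.mul_self_sqrt (show (0 : ℝ) ≤ d / 8 by positivity)]
    exact mul_le_mul (Real.sqrt_le_sqrt (hA j)) (Real.sqrt_le_sqrt (hB j)) (Real.sqrt_nonneg _)
      (Real.sqrt_nonneg _)
  calc _ ≤ ‖D‖ * ‖offGram pairTensor (colPairs A B)‖ * ‖D‖ :=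
        (l2_opNorm_mul _ _).trans (by gcongr; exact l2_opNorm_mul _ _)
    _ ≤ 8 / d * ‖offGram pairTensor (colPairs A B)‖ * (8 / d) := by gcongr
    _ = _ := by ring

/-- A complement version of `Measure.le_map_apply`. -/
lemma one_sub_le_measureReal_of_map {β : Type*} [MeasurableSpace β] {f : Ω → β}
    (hf : AEMeasurable f P) {s : Set β} {q : ℝ} (hq : 0 ≤ q)
    (hs : Measure.map f P s ≤ ENNReal.ofReal q) {G : Set Ω} (hG : ∀ ω, f ω ∉ s → ω ∈ G) :
    1 - q ≤ P.real G := by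
  have h1 : P (f ⁻¹' s) ≤ ENNReal.ofReal q := (Measure.le_map_apply hf s).trans hs
  have h2 : P.real (f ⁻¹' s) ≤ q := ENNReal.toReal_le_of_le_ofReal hq h1
  have h3 : (Set.univ : Set Ω) ⊆ G ∪ f ⁻¹' s := fun ω _ => by
    by_cases h : f ω ∈ s
    · exact Or.inr h
    · exact Or.inl (hG ω h)
  have h4 := (measureReal_mono h3).trans (measureReal_union_le (μ := P) _ _)
  rw [probReal_univ] at h4
  linarith

end Transport

theorem mainTheorem8 :
    (∀ (d k : ℕ) (A B : Matrix (Fin d) (Fin k) ℝ),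
      khatriRaoGram A B = Matrix.hadamard (A.transpose * A) (B.transpose * B)) ∧
    ∃ p q : ℕ, ∀ c : ℝ, 0 < c → ∃ C : ℝ, 0 < C ∧ ∃ d₀ : ℕ, ∀ d : ℕ, d₀ ≤ d → ∀ k : ℕ,
      Real.log d ^ p < k → (k : ℝ) ≤ (d : ℝ) ^ 2 / Real.log d ^ q →
      ∀ (Ω : Type*) [MeasurableSpace Ω] (P : Measure Ω) [IsProbabilityMeasure P]
        (A B : Ω → Matrix (Fin d) (Fin k) ℝ),
        IsGaussianMatrix A P → IsGaussianMatrix B P →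
        IndepFun (fun ω (ij : Fin d × Fin k) => A ω ij.1 ij.2)
          (fun ω (ij : Fin d × Fin k) => B ω ij.1 ij.2) P →
        1 - (d : ℝ) ^ (-c) ≤
            P.real {ω | ‖khatriRaoGram (A ω) (B ω)
                - Matrix.diagonal (khatriRaoGram (A ω) (B ω)).diag‖
              ≤ C * (d * √(k * Real.log d))} ∧
        1 - (d : ℝ) ^ (-c) ≤
            P.real {ω | ‖khatriRaoGram (normalizeCols (A ω)) (normalizeCols (B ω)) - 1‖
              ≤ C * (√(k * Real.log d) / d)} := by
  -- The range (log d)³ < k ≤ d² suffices, so `q = 0` loses no logarithm at the upper end.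
  refine ⟨fun d k A B => khatriRaoGram_eq_hadamard A B, 3, 0, fun c hc => ?_⟩
  obtain ⟨C, hC, d₀, hd₀, hmain⟩ := exists_measure_offGram_bad_le hc
  -- The factor 64 is 8 · 8, from the two diagonal matrices of norm at most 8/d; the first claim
  -- would hold with `C` itself.
  refine ⟨64 * C, by positivity, d₀, fun d hd k hk1 hk2 Ω _ P _ A B hA hB hAB => ?_⟩
  have hdn : 0 < d := lt_of_lt_of_le hd₀ hd
  have hd0 : (0 : ℝ) < d := by exact_mod_cast hdn
  have hbad := hmain d hd k hk1 (by simpa using hk2)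
  obtain ⟨hm, hmap⟩ := map_colPairs hA hB hAB
  rw [← hmap] at hbad
  have hq : (0 : ℝ) ≤ (d : ℝ) ^ (-c) := by positivity
  have hgood : ∀ ω, colPairs (A ω) (B ω) ∉
      ({v | C * (d * √(k * Real.log d)) < ‖offGram pairTensor v‖} ∪ normBad d k) →
      ‖offGram pairTensor (colPairs (A ω) (B ω))‖ ≤ C * (d * √(k * Real.log d)) :=
    fun ω hω => not_lt.1 fun h => hω (Or.inl h)
  have hs : 0 ≤ C * (d * √(k * Real.log d)) := by positivity
  refine ⟨one_sub_le_measureReal_of_map hm hq hbad fun ω hω => ?_,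
    one_sub_le_measureReal_of_map hm hq hbad fun ω hω => ?_⟩
  · rw [Set.mem_ofPred_eq, khatriRaoGram_sub_diagonal]
    linarith [hgood ω hω]
  · rw [Set.mem_ofPred_eq]
    refine (norm_khatriRaoGram_normalizeCols_sub_one_le hdn fun h => hω (Or.inr h)).trans ?_
    calc _ ≤ 64 / (d : ℝ) ^ 2 * (C * (d * √(k * Real.log d))) := by
          gcongr
          exact hgood ω hω
      _ = _ := by field_simp
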